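/- All graphs are simple and locally finite. A random rooted graph is a random isomorphism class of connected graphs $G=(V,E)$ with a distinguished vertex $\rho$ (and possibly marks on the vertices and edges), with respect to the Borel $\sigma$-algebra of the local topology. It is unimodular if $\mathbb E\big[\sum_{o\in V}f(G,\rho,o)\big]=\mathbb E\big[\sum_{o\in V}f(G,o,\rho)\big]$ for every nonnegative Borel function $f$ of doubly rooted (marked) graphs. A percolation of a unimodular random rooted (marked) graph is a random $\{0,1\}$-marking $\omega$ of its vertices and edges, possibly using additional randomness, such that the graph with $\omega$ added to its marks is again unimodular, and such that a.s. both endpoints of every edge $e$ with $\omega(e)=1$ have mark $1$. Elements with mark $1$ are called open, and $G[\omega]$ is the subgraph of open vertices and open edges. It is a site percolation if a.s. every edge with two open endpoints is open. Its rate is $\mathbb P[\omega(\rho)=0]$. **Theorem 4.1.** Let $(G,\rho)$ be a unimodular random rooted graph, let $D$ be a positive integer, and let $\xi$ be a percolation of $(G,\rho)$ such that a.s. every vertex of $G_D:=G[\xi]$ has degree at most $D$ in $G_D$. Then, for every real $\alpha>0$, there is a site percolation $\omega_\alpha$ of $(G,\rho,\xi)$ of rate at most $\alpha$ such that a.s.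 every infinite connected component $C$ of $G_D[\omega_\alpha]$ (the subgraph of the vertices and edges of $G_D$ that are open with respect to $\omega_\alpha$) has inner vertex-expansion constant at least $\alpha$, that is, $$\inf\left\{\frac{|\{u\in K : u\text{ is adjacent in } C\text{ to some vertex not in }K\}|}{|K|} \;:\; \emptyset\neq K\subseteq V(C)\text{ finite}\right\}\ \ge\ \alpha .$$ -/

import Mathlib

open MeasureTheory
open scoped ENNReal

/-! ## Marked graphs with distinguished vertices and the local topology -/

namespace LocalGraph

/-- A locally finite connected (simple) graph with `k` distinguished vertices (roots) and a mark in
`X` on every vertex and every edge. Such a graph is countable, so that restricting the vertex set to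
live in `Type` loses no isomorphism class. The values of `emark` outside of the edge set carry no
meaning: they are ignored by isomorphisms, hence disappear in the space `GraphSpace`. -/
structure MarkedGraph (k : ℕ) (X : Type) : Type 1 where
  /-- the vertex set -/
  V : Type
  /-- the underlying graph -/
  graph : SimpleGraph V
  connected : graph.Connected
  locallyFinite : ∀ v, (graph.neighborSet v).Finite
  /-- the roots -/
  root : Fin k → V
  /-- the marks of the vertices -/
  vmark : V → X
  /-- the marks of the edges -/
  emark : Sym2 V → X

namespace MarkedGraph

variable {k : ℕ} {X Y : Type}

/-- Isomorphism of rooted marked graphs: a graph isomorphism that preserves the roots, the marks of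
the vertices and the marks of the edges. -/
def Isomorphic (G H : MarkedGraph k X) : Prop :=
  ∃ φ : G.graph ≃g H.graph,
    (∀ i, φ (G.root i) = H.root i) ∧
    (∀ v, H.vmark (φ v) = G.vmark v) ∧
    (∀ u v, G.graph.Adj u v → H.emark s(φ u, φ v) = G.emark s(u, v))

instance setoid (k : ℕ) (X : Type) : Setoid (MarkedGraph k X) where
  r := Isomorphic
  iseqv :=
    { refl := fun G => ⟨SimpleGraph.Iso.refl, fun _ => rfl, fun _ => rfl, fun _ _ _ => rfl⟩
      symm := by
        rintro G H ⟨φ, h1, h2, h3⟩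
        refine ⟨φ.symm, fun i => ?_, fun v => ?_, fun u v huv => ?_⟩
        · rw [← h1 i]; exact φ.symm_apply_apply _
        · rw [← h2 (φ.symm v)]; exact congrArg _ (φ.apply_symm_apply v)
        · rw [← h3 (φ.symm u) (φ.symm v) (φ.symm.map_rel_iff.2 huv)]
          simp
      trans := by
        rintro G H K ⟨φ, h1, h2, h3⟩ ⟨ψ, g1, g2, g3⟩
        refine ⟨φ.trans ψ, fun i => ?_, fun v => ?_, fun u v huv => ?_⟩
        · exact (congrArg ψ (h1 i)).trans (g1 i)
        · exact (g2 (φ v)).trans (h2 v)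
        · exact (g3 (φ u) (φ v) (φ.map_rel_iff.2 huv)).trans (h3 u v huv) }

/-- The vertices within distance `r` of some root. -/
def ball (G : MarkedGraph k X) (r : ℕ) : Set G.V :=
  {v | ∃ i, G.graph.dist (G.root i) v ≤ r}

theorem root_mem_ball (G : MarkedGraph k X) (r : ℕ) (i : Fin k) : G.root i ∈ G.ball r :=
  ⟨i, by simp⟩

/-- The neighbourhoods of radius `r` of the roots, as induced rooted marked subgraphs, are
isomorphic. -/
def LocallyIsomorphic (r : ℕ) (G H : MarkedGraph k X) : Prop :=
  ∃ φ : G.graph.induce (G.ball r) ≃g H.graph.induce (H.ball r),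
    (∀ i, φ ⟨G.root i, G.root_mem_ball r i⟩ = ⟨H.root i, H.root_mem_ball r i⟩) ∧
    (∀ v, H.vmark (φ v) = G.vmark v) ∧
    (∀ u v : G.ball r, G.graph.Adj u v →
      H.emark s((φ u : H.V), (φ v : H.V)) = G.emark s((u : G.V), (v : G.V)))

/-- The same marked graph with other roots. -/
def withRoots {l : ℕ} (G : MarkedGraph k X) (root : Fin l → G.V) : MarkedGraph l X :=
  { G with root := root }

/-- Apply a function to all marks. -/
def mapMarks (g : X → Y) (G : MarkedGraph k X) : MarkedGraph k Y :=
  { G with vmark := fun v => g (G.vmark v), emark := fun e => g (G.emark e) }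

end MarkedGraph

/-- The space of isomorphism classes of `k`-rooted graphs with marks in `X`: rooted graphs for
`k = 1` and doubly rooted graphs for `k = 2`. -/
def GraphSpace (k : ℕ) (X : Type) : Type 1 := Quotient (MarkedGraph.setoid k X)

namespace GraphSpace

variable {k : ℕ} {X Y : Type}

/-- The isomorphism class of a rooted marked graph. -/
def mk (G : MarkedGraph k X) : GraphSpace k X := Quotient.mk _ G

/-- The local topology, for marks in a finite (discrete) set `X`: it is generated by the sets of
classes that agree with a given graph up to radius `r`, which are the balls of the metric `2 ^ (-R)`
with `R` the supremum of the radii up to which two graphs agree. -/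
instance : TopologicalSpace (GraphSpace k X) :=
  TopologicalSpace.generateFrom
    {U | ∃ (r : ℕ) (G : MarkedGraph k X), U = mk '' {H | G.LocallyIsomorphic r H}}

/-- The Borel sigma-algebra of the local topology. -/
instance : MeasurableSpace (GraphSpace k X) := borel _

instance : BorelSpace (GraphSpace k X) := ⟨rfl⟩

/-- Apply a function to all marks of (the isomorphism class of) a graph. -/
def mapMarks (g : X → Y) : GraphSpace k X → GraphSpace k Y :=
  Quotient.lift (fun G => mk (G.mapMarks g)) (by
    rintro G H ⟨φ, h1, h2, h3⟩
    exact Quotient.sound ⟨φ, h1, fun v => congrArg g (h2 v), fun u v h => congrArg g (h3 u v h)⟩)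

/-- The isomorphism class `x` has the (isomorphism invariant) property `P`. -/
def Satisfies (P : MarkedGraph k X → Prop) (x : GraphSpace k X) : Prop :=
  ∀ G : MarkedGraph k X, mk G = x → P G

/-- The total mass `∑ o, f (G, ρ, o)` that is sent out from the root. -/
noncomputable def massOut (f : GraphSpace 2 X → ℝ≥0∞) : GraphSpace 1 X → ℝ≥0∞ :=
  Quotient.lift (fun G => ∑' o : G.V, f (mk (G.withRoots ![G.root 0, o]))) (by
    rintro G H ⟨φ, h1, h2, h3⟩
    refine Eq.trans (tsum_congr fun o => congrArg f (Quotient.sound ?_))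
      (φ.toEquiv.tsum_eq fun o => f (mk (H.withRoots ![H.root 0, o])))
    refine ⟨φ, fun i => ?_, h2, h3⟩
    fin_cases i
    · exact h1 0
    · rfl)

/-- The total mass `∑ o, f (G, o, ρ)` that is received by the root. -/
noncomputable def massIn (f : GraphSpace 2 X → ℝ≥0∞) : GraphSpace 1 X → ℝ≥0∞ :=
  Quotient.lift (fun G => ∑' o : G.V, f (mk (G.withRoots ![o, G.root 0]))) (by
    rintro G H ⟨φ, h1, h2, h3⟩
    refine Eq.trans (tsum_congr fun o => congrArg f (Quotient.sound ?_))
      (φ.toEquiv.tsum_eq fun o => f (mk (H.withRoots ![o, H.root 0])))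
    refine ⟨φ, fun i => ?_, h2, h3⟩
    fin_cases i
    · rfl
    · exact h1 0)

end GraphSpace

/-! ## Unimodularity, markings and percolations

Random rooted graphs are given by their laws. -/

open GraphSpace

/-- The law `μ` of a random rooted marked graph is unimodular: it satisfies the mass transport
principle. -/
def IsUnimodular {X : Type} (μ : Measure (GraphSpace 1 X)) : Prop :=
  ∀ f : GraphSpace 2 X → ℝ≥0∞, Measurable f → ∫⁻ x, massOut f x ∂μ = ∫⁻ x, massIn f x ∂μ

/-- `ν` is the law of `(G, ρ, m, m')`, where `(G, ρ, m)` has law `μ` and `m'` is a `Y`-marking of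
`(G, ρ, m)`, possibly using additional randomness: the random rooted graph `(G, ρ, m, m')` is
unimodular. -/
structure IsMarking {X Y : Type} (μ : Measure (GraphSpace 1 X))
    (ν : Measure (GraphSpace 1 (X × Y))) : Prop where
  isProbabilityMeasure : IsProbabilityMeasure ν
  isUnimodular : IsUnimodular ν
  map_eq : ν.map (mapMarks Prod.fst) = μ

/-- `ν` is the law of `(G, ρ, m, ω)`, where `(G, ρ, m)` has law `μ` and `ω` is a percolation of
`(G, ρ, m)`, with `true` for open and `false` for closed: a marking for which both endpoints of an
open edge are open. -/
structure IsPercolation {X : Type} (μ : Measure (GraphSpace 1 X))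
    (ν : Measure (GraphSpace 1 (X × Bool))) : Prop extends IsMarking μ ν where
  open_of_open : ∀ᵐ x ∂ν, x.Satisfies fun G => ∀ u v, G.graph.Adj u v →
    (G.emark s(u, v)).2 = true → (G.vmark u).2 = true ∧ (G.vmark v).2 = true

/-- A percolation is a site percolation if every edge with two open endpoints is open. -/
structure IsSitePercolation {X : Type} (μ : Measure (GraphSpace 1 X))
    (ν : Measure (GraphSpace 1 (X × Bool))) : Prop extends IsPercolation μ ν where
  open_edge : ∀ᵐ x ∂ν, x.Satisfies fun G => ∀ u v, G.graph.Adj u v →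
    (G.vmark u).2 = true → (G.vmark v).2 = true → (G.emark s(u, v)).2 = true

/-- The rate of a percolation: the probability that the root is closed. -/
noncomputable def rate {X : Type} (ν : Measure (GraphSpace 1 (X × Bool))) : ℝ :=
  ν.real {x | x.Satisfies fun G => (G.vmark (G.root 0)).2 = false}

/-- The subgraph that consists of the open vertices and the open edges, where a mark `m` is read as
open if `p m = true`. -/
def MarkedGraph.openSubgraph {k : ℕ} {X : Type} (G : MarkedGraph k X) (p : X → Bool) :
    G.graph.Subgraph where
  verts := {v | p (G.vmark v) = true}
  Adj u v := G.graph.Adj u v ∧ p (G.emark s(u, v)) = true ∧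
    p (G.vmark u) = true ∧ p (G.vmark v) = true
  adj_sub h := h.1
  edge_vert h := h.2.2.1
  symm := ⟨fun u v h => ⟨h.1.symm, by rw [Sym2.eq_swap]; exact h.2.1, h.2.2.2, h.2.2.1⟩⟩

end LocalGraph

/-! ## Vertex expansion -/

namespace SimpleGraph

variable {V : Type*}

/-- The inner vertex boundary of `K`: the vertices of `K` with a neighbour outside of `K`. -/
def innerBoundary (G : SimpleGraph V) (K : Set V) : Set V :=
  {u | u ∈ K ∧ ∃ w, w ∉ K ∧ G.Adj u w}

/-- The inner vertex-expansion constant: the infimum of `|∂K| / |K|` over the nonempty finite sets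
`K` of vertices, with `∂K` the inner vertex boundary of `K`. -/
noncomputable def innerVertexExpansionConstant (G : SimpleGraph V) : ℝ :=
  ⨅ K : {K : Finset V // K.Nonempty}, ((G.innerBoundary K.1).ncard : ℝ) / (K.1.card : ℝ)

end SimpleGraph

/-! ## Removal of the boundaries of randomly selected finite sets -/

namespace Thinning

variable {V W : Type*}

/-! The closed vertices come from a random greedy procedure on the open graph `A` of `ξ`. At every
time each vertex tosses a fresh fair coin. Among the finite connected components `K` of the alive
vertices showing heads, those with fewer than `α * |K|` boundary vertices towards the alive set are
selected: their boundary is closed, and all of `K` ceases to be alive.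

Rate: a vertex lies in at most one selected set (`Selected.unique`). If each vertex of a selected
`K` sends mass `1 / |K|` to each boundary vertex of `K`, then at most `α` leaves any vertex
(`tsum_charge_le`) and at least `1` reaches every closed one (`one_le_tsum_charge`). The mass
transport principle bounds the rate by `α` (`IsThinnedLaw.rate_le`).

Expansion: what stays open of a selected set is cut off from all other open vertices
(`Selected.mem_of_remaining`), so an infinite remaining component contains no vertex that was ever
selected. A finite subset with small boundary would contain a connected `T` with small boundary
(`exists_cutConnected_subset`). The states of the neighbours of `T` stabilise, and almost surely at
some later time `T` shows heads while its other neighbours show tails (`ae_generic`). Then `T` would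
be selected, a contradiction (`expanding_compl_removed`).

Measurability: isomorphism classes are coded by graphs on `ℕ`, and measurable functions of codes
descend to classes (`Code.measurable_of_code`). The construction and the law of the coins are
isomorphism invariant, so the law of the thinned graph is a kernel `κ` on classes (`exists_law`).
The percolation is `Ξ.bind κ`; it is unimodular because averaging a transport over the coins gives a
transport on the original graph (`IsThinnedLaw.isUnimodular`). -/

open Classical in
/-- The vertices of `K` with a neighbour in `L` outside of `K`. -/
noncomputable def boundary (A : V → V → Prop) (L : Set V) (K : Finset V) : Finset V :=
  K.filter fun u => ∃ w ∈ L, w ∉ K ∧ A u w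

theorem mem_boundary {A : V → V → Prop} {L : Set V} {K : Finset V} {u : V} :
    u ∈ boundary A L K ↔ u ∈ K ∧ ∃ w ∈ L, w ∉ K ∧ A u w := by
  classical
  simp [boundary]

/-- Connectedness of a finite set, expressed by cuts. -/
def CutConnected (A : V → V → Prop) (K : Finset V) : Prop :=
  ∀ T ⊆ K, T.Nonempty → T ≠ K → ∃ u ∈ T, ∃ w ∈ K, w ∉ T ∧ A u w

/-- `K` is a finite connected component of `L ∩ B` whose boundary in `L` is small. -/
structure Sel (A : V → V → Prop) (α : ℝ) (L B : Set V) (K : Finset V) : Prop where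
  nonempty : K.Nonempty
  sub : ∀ u ∈ K, u ∈ L ∧ u ∈ B
  conn : CutConnected A K
  maximal : ∀ u ∈ K, ∀ w, w ∈ L → w ∈ B → A u w → w ∈ K
  small : ((boundary A L K).card : ℝ) < α * K.card

/-- If `K ∩ K'` were a proper part of the connected set `K`, an edge would leave it inside `K`, and
maximality of `K'` would absorb its endpoint. -/
theorem Sel.subset_of_mem {A : V → V → Prop} {α : ℝ} {L B : Set V} {K K' : Finset V}
    (h : Sel A α L B K) (h' : Sel A α L B K') {v : V} (hv : v ∈ K) (hv' : v ∈ K') : K ⊆ K' := by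
  classical
  by_contra hne
  obtain ⟨u, hu, w, hw, hwT, huw⟩ := h.conn (K ∩ K') Finset.inter_subset_left
    ⟨v, Finset.mem_inter.2 ⟨hv, hv'⟩⟩ (fun e => hne (Finset.inter_eq_left.1 e))
  exact hwT (Finset.mem_inter.2 ⟨hw, h'.maximal u (Finset.mem_inter.1 hu).2 w (h.sub w hw).1
    (h.sub w hw).2 huw⟩)

theorem Sel.eq_of_mem {A : V → V → Prop} {α : ℝ} {L B : Set V} {K K' : Finset V}
    (h : Sel A α L B K) (h' : Sel A α L B K') {v : V} (hv : v ∈ K) (hv' : v ∈ K') : K = K' :=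
  (h.subset_of_mem h' hv hv').antisymm (h'.subset_of_mem h hv' hv)

/-- The vertices that belong to no set selected before time `n`. -/
def alive (A : V → V → Prop) (α : ℝ) (b : ℕ → V → Bool) : ℕ → Set V
  | 0 => Set.univ
  | n + 1 => {v | v ∈ alive A α b n ∧
      ∀ K : Finset V, Sel A α (alive A α b n) {v | b n v = true} K → v ∉ K}

/-- The set `K` is selected at time `n`. -/
def Selected (A : V → V → Prop) (α : ℝ) (b : ℕ → V → Bool) (n : ℕ) (K : Finset V) : Prop :=
  Sel A α (alive A α b n) {v | b n v = true} K

/-- The vertices in the boundary of a selected set. -/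
def removed (A : V → V → Prop) (α : ℝ) (b : ℕ → V → Bool) : Set V :=
  {v | ∃ n K, Selected A α b n K ∧ v ∈ boundary A (alive A α b n) K}

/-! ### The selection dynamics and expansion of what remains -/

section Dynamics

variable {A : V → V → Prop} {α : ℝ} {b : ℕ → V → Bool}

theorem alive_antitone : Antitone (alive A α b) :=
  antitone_nat_of_succ_le fun _ _ h => h.1

theorem mem_alive_succ {n : ℕ} {v : V} :
    v ∈ alive A α b (n + 1) ↔ v ∈ alive A α b n ∧ ∀ K, Selected A α b n K → v ∉ K :=
  Iff.rfl

theorem Selected.notMem_alive {n m : ℕ} {K : Finset V} (h : Selected A α b n K) {v : V}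
    (hv : v ∈ K) (hm : n < m) : v ∉ alive A α b m := fun hv' =>
  (mem_alive_succ.1 (alive_antitone (Nat.succ_le_of_lt hm) hv')).2 K h hv

/-- A vertex is no longer alive after its selection, so the times agree; sets selected at the same
time are components of one graph. This is what limits the mass sent by a vertex. -/
theorem Selected.unique {n m : ℕ} {K K' : Finset V} (h : Selected A α b n K)
    (h' : Selected A α b m K') {v : V} (hv : v ∈ K) (hv' : v ∈ K') : n = m ∧ K = K' := by
  rcases lt_trichotomy n m with hnm | rfl | hnm
  · exact absurd (h'.sub v hv').1 (h.notMem_alive hv hnm)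
  · exact ⟨rfl, Sel.eq_of_mem h h' hv hv'⟩
  · exact absurd (h.sub v hv).1 (h'.notMem_alive hv' hnm)

theorem exists_selected_of_notMem_alive {n : ℕ} {v : V} (h : v ∉ alive A α b n) :
    ∃ m < n, ∃ K, Selected A α b m K ∧ v ∈ K := by
  induction n with
  | zero => exact absurd (Set.mem_univ v) h
  | succ n ih =>
    by_cases hv : v ∈ alive A α b n
    · by_contra! hK
      exact h (mem_alive_succ.2 ⟨hv, fun K hKs => hK n n.lt_succ_self K hKs⟩)
    · obtain ⟨m, hm, K, hK⟩ := ih hv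
      exact ⟨m, hm.trans n.lt_succ_self, K, hK⟩

/-- The relation induced on the vertices that are not removed. -/
def remaining (A : V → V → Prop) (α : ℝ) (b : ℕ → V → Bool) (u v : V) : Prop :=
  A u v ∧ u ∉ removed A α b ∧ v ∉ removed A α b

/-- The part of a selected set that is not in its boundary is separated from the other remaining
vertices. -/
theorem Selected.mem_of_remaining (hA : ∀ u v, A u v → A v u) {n : ℕ} {K : Finset V}
    (h : Selected A α b n K) {x w : V} (hx : x ∈ K) (hxw : remaining A α b x w) : w ∈ K := by
  by_contra hw
  -- If `w` is alive at time `n`, the edge puts `x` into the boundary of `K`. Otherwise `w` lies in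
  -- a set `K'` selected earlier, when `x` was alive and outside `K'`, so `w` is in the boundary of
  -- `K'`. Either way an endpoint is removed.
  by_cases hwL : w ∈ alive A α b n
  · exact hxw.2.1 ⟨n, K, h, mem_boundary.2 ⟨hx, w, hwL, hw, hxw.1⟩⟩
  · obtain ⟨m, hm, K', hK', hwK'⟩ := exists_selected_of_notMem_alive hwL
    have hxm : x ∉ K' := fun hxK' => hK'.notMem_alive hxK' hm (h.sub x hx).1
    exact hxw.2.2 ⟨m, K', hK', mem_boundary.2
      ⟨hwK', x, alive_antitone hm.le (h.sub x hx).1, hxm, hA _ _ hxw.1⟩⟩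

/-- Every finite set with small boundary contains one that is connected. -/
theorem exists_cutConnected_subset (hA : ∀ u v, A u v → A v u) (L : Set V) (K : Finset V)
    (hK : K.Nonempty) (hs : ((boundary A L K).card : ℝ) < α * K.card) (hL : ∀ u ∈ K, u ∈ L) :
    ∃ T ⊆ K, T.Nonempty ∧ CutConnected A T ∧ ((boundary A L T).card : ℝ) < α * T.card := by
  classical
  induction K using Finset.strongInduction with
  | H K ih =>
    by_cases hc : CutConnected A K
    · exact ⟨K, subset_rfl, hK, hc, hs⟩
    · simp only [CutConnected, not_forall] at hc
      obtain ⟨T, hTK, hT, hne, hcut⟩ := hc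
      push Not at hcut
      have hT' : (K \ T).Nonempty := Finset.sdiff_nonempty.2 fun h => hne (hTK.antisymm h)
      -- No edge joins `T` to `K \ T`, so the boundary of `K` contains both boundaries, which are
      -- disjoint. Hence one of the two parts inherits a ratio below `α`.
      have hsub : boundary A L T ∪ boundary A L (K \ T) ⊆ boundary A L K := by
        intro u hu
        rcases Finset.mem_union.1 hu with hu | hu <;> rw [mem_boundary] at hu ⊢
        · obtain ⟨hu, w, hwL, hw, huw⟩ := hu
          exact ⟨hTK hu, w, hwL, fun hwK => hcut u hu w hwK hw huw, huw⟩
        · obtain ⟨hu, w, hwL, hw, huw⟩ := hu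
          rw [Finset.mem_sdiff] at hu hw
          refine ⟨hu.1, w, hwL, fun hwK => ?_, huw⟩
          have hwT : w ∈ T := by by_contra h; exact hw ⟨hwK, h⟩
          exact hcut w hwT u hu.1 hu.2 (hA _ _ huw)
      have hdis : Disjoint (boundary A L T) (boundary A L (K \ T)) := by
        rw [Finset.disjoint_left]
        intro u hu hu'
        exact (Finset.mem_sdiff.1 (mem_boundary.1 hu').1).2 (mem_boundary.1 hu).1
      have hcard := Finset.card_le_card hsub
      rw [Finset.card_union_of_disjoint hdis] at hcard
      have hcardK : (K \ T).card + T.card = K.card := Finset.card_sdiff_add_card_eq_card hTK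
      have h1 : ((boundary A L T).card : ℝ) + (boundary A L (K \ T)).card ≤
        (boundary A L K).card := by exact_mod_cast hcard
      have h2 : ((K \ T).card : ℝ) + T.card = K.card := by exact_mod_cast hcardK
      have hcases : ((boundary A L T).card : ℝ) < α * T.card ∨
          ((boundary A L (K \ T)).card : ℝ) < α * (K \ T).card := by
        by_contra! h
        rw [← h2] at hs
        linarith [h.1, h.2, mul_add α ((K \ T).card : ℝ) T.card]
      rcases hcases with h | h
      · obtain ⟨S, hS, h3⟩ := ih T (hTK.ssubset_of_ne hne) hT h fun u hu => hL u (hTK hu)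
        exact ⟨S, hS.trans hTK, h3⟩
      · obtain ⟨S, hS, h3⟩ := ih (K \ T)
          (Finset.sdiff_subset.ssubset_of_ne fun e => by
            obtain ⟨t, ht⟩ := hT
            exact (Finset.mem_sdiff.1 (Finset.ext_iff.1 e t |>.2 (hTK ht))).2 ht) hT' h
          fun u hu => hL u (Finset.sdiff_subset hu)
        exact ⟨S, hS.trans Finset.sdiff_subset, h3⟩

/-- Every finite pattern appears in `b` at arbitrarily late times. -/
def Generic (b : ℕ → V → Bool) : Prop :=
  ∀ (S T : Finset V) (n₀ : ℕ), Disjoint S T →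
    ∃ n ≥ n₀, (∀ v ∈ S, b n v = true) ∧ ∀ v ∈ T, b n v = false

/-- A finite set of remaining vertices with small boundary meets a finite union of connected
components of the graph on the remaining vertices. -/
def Expanding (A : V → V → Prop) (α : ℝ) (O : Set V) : Prop :=
  ∀ K : Finset V, K.Nonempty → (∀ u ∈ K, u ∈ O) →
    ((boundary A O K).card : ℝ) < α * K.card →
    ∃ F : Finset V, (∃ u ∈ K, u ∈ F) ∧ ∀ u ∈ F, u ∈ O → ∀ w ∈ O, A u w → w ∈ F

theorem expanding_compl_removed (hA : ∀ u v, A u v → A v u) (hfin : ∀ u, {w | A u w}.Finite)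
    (hb : Generic b) : Expanding A α (removed A α b)ᶜ := by
  classical
  intro K hK hKO hs
  by_cases hdead : ∃ u ∈ K, ∃ n K', Selected A α b n K' ∧ u ∈ K'
  · obtain ⟨u, hu, n, K', hK', huK'⟩ := hdead
    exact ⟨K', ⟨u, hu, huK'⟩, fun x hx hxO w hwO hxw => hK'.mem_of_remaining hA hx ⟨hxw, hxO, hwO⟩⟩
  · exfalso
    push Not at hdead
    obtain ⟨T, hTK, hT, hTc, hTs⟩ := exists_cutConnected_subset hA _ K hK hs hKO
    let N : Finset V := T.biUnion fun u => (hfin u).toFinset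
    have hN : ∀ u ∈ T, ∀ w, A u w → w ∈ N := fun u hu w huw =>
      Finset.mem_biUnion.2 ⟨u, hu, by simpa using huw⟩
    -- Each vertex dies at most once and `N` is finite, so from some time on the survivors in `N`
    -- survive for ever.
    have hstab : ∃ n₀, ∀ w ∈ N, w ∈ alive A α b n₀ → ∀ n, w ∈ alive A α b n := by
      have h1 : ∀ w : V, ∃ m, w ∈ alive A α b m → ∀ n, w ∈ alive A α b n := by
        intro w
        by_cases h : ∀ n, w ∈ alive A α b n
        · exact ⟨0, fun _ => h⟩
        · push Not at h
          obtain ⟨m, hm⟩ := h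
          exact ⟨m, fun h => absurd h hm⟩
      choose m hm using h1
      exact ⟨N.sup m, fun w hw h => hm w (alive_antitone (Finset.le_sup hw) h)⟩
    obtain ⟨n₀, hn₀⟩ := hstab
    -- Tails on the neighbours outside `T` make `T` a full component of the heads.
    obtain ⟨n, hn, hnT, hnN⟩ := hb T (N \ T) n₀ Finset.disjoint_sdiff
    have hTalive : ∀ u ∈ T, ∀ m, u ∈ alive A α b m := by
      intro u hu m
      by_contra h
      obtain ⟨k, -, K', hK', huK'⟩ := exists_selected_of_notMem_alive h
      exact hdead u (hTK hu) k K' hK' huK'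
    -- A neighbour alive at the late time `n` is never selected, hence never removed.
    have hbd : boundary A (alive A α b n) T ⊆ boundary A (removed A α b)ᶜ T := by
      intro u hu
      rw [mem_boundary] at hu ⊢
      obtain ⟨hu, w, hwL, hw, huw⟩ := hu
      refine ⟨hu, w, ?_, hw, huw⟩
      rintro ⟨k, K', hK', hwK'⟩
      exact hK'.notMem_alive (mem_boundary.1 hwK').1 k.lt_succ_self
        (hn₀ w (hN u hu w huw) (alive_antitone hn hwL) _)
    have hsel : Selected A α b n T :=
      ⟨hT, fun u hu => ⟨hTalive u hu n, hnT u hu⟩, hTc, fun u hu w _ hwB huw => by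
        by_contra hw
        have := hnN w (Finset.mem_sdiff.2 ⟨hN u hu w huw, hw⟩)
        simp only [Set.mem_ofPred_eq, this] at hwB
        exact absurd hwB (by simp),
        lt_of_le_of_lt (by exact_mod_cast Finset.card_le_card hbd) hTs⟩
    obtain ⟨u, hu⟩ := hT
    exact hdead u (hTK hu) n T hsel hu

end Dynamics

/-! ### Naturality under embeddings whose range is closed under adjacency -/

section Naturality

variable {A : V → V → Prop} {A' : W → W → Prop} {α : ℝ} (ι : V ↪ W)

theorem boundary_map (hι : ∀ u v, A u v ↔ A' (ι u) (ι v))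
    (hcl : ∀ u w, A' (ι u) w → w ∈ Set.range ι) (L : Set W) (K : Finset V) :
    boundary A' L (K.map ι) = (boundary A (ι ⁻¹' L) K).map ι := by
  ext x
  simp only [mem_boundary, Finset.mem_map]
  constructor
  · rintro ⟨⟨u, hu, rfl⟩, w, hw, hwK, huw⟩
    obtain ⟨w, rfl⟩ := hcl _ _ huw
    exact ⟨u, ⟨hu, w, hw, fun h => hwK ⟨w, h, rfl⟩, (hι _ _).2 huw⟩, rfl⟩
  · rintro ⟨u, ⟨hu, w, hw, hwK, huw⟩, rfl⟩
    refine ⟨⟨u, hu, rfl⟩, ι w, hw, ?_, (hι _ _).1 huw⟩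
    rintro ⟨w', hw', e⟩
    exact hwK (ι.injective e ▸ hw')

theorem cutConnected_map (hι : ∀ u v, A u v ↔ A' (ι u) (ι v)) (K : Finset V) :
    CutConnected A' (K.map ι) ↔ CutConnected A K := by
  classical
  constructor
  · intro h T hTK hT hne
    obtain ⟨u, hu, w, hw, hwT, huw⟩ := h (T.map ι) (Finset.map_subset_map.2 hTK) (by simpa)
      (fun e => hne (Finset.map_injective ι e))
    obtain ⟨u, hu', rfl⟩ := Finset.mem_map.1 hu
    obtain ⟨w, hw', rfl⟩ := Finset.mem_map.1 hw
    exact ⟨u, hu', w, hw', fun h => hwT (Finset.mem_map_of_mem _ h), (hι _ _).2 huw⟩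
  · intro h T hTK hT hne
    obtain ⟨T, hTK', rfl⟩ := Finset.subset_map_iff.1 hTK
    obtain ⟨u, hu, w, hw, hwT, huw⟩ := h T hTK' (by simpa using hT) (fun e => hne (by rw [e]))
    exact ⟨ι u, Finset.mem_map_of_mem _ hu, ι w, Finset.mem_map_of_mem _ hw,
      fun h => hwT (by simpa using h), (hι _ _).1 huw⟩

theorem sel_map (hι : ∀ u v, A u v ↔ A' (ι u) (ι v))
    (hcl : ∀ u w, A' (ι u) w → w ∈ Set.range ι) (L B : Set W) (K : Finset V) :
    Sel A' α L B (K.map ι) ↔ Sel A α (ι ⁻¹' L) (ι ⁻¹' B) K := by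
  constructor
  · rintro ⟨h1, h2, h3, h4, h5⟩
    refine ⟨by simpa using h1, fun u hu => h2 _ (Finset.mem_map_of_mem _ hu),
      (cutConnected_map ι hι K).1 h3, fun u hu w hwL hwB huw => ?_, ?_⟩
    · simpa using h4 _ (Finset.mem_map_of_mem ι hu) (ι w) hwL hwB ((hι _ _).1 huw)
    · simpa [boundary_map ι hι hcl] using h5
  · rintro ⟨h1, h2, h3, h4, h5⟩
    refine ⟨by simpa using h1, fun u hu => ?_, (cutConnected_map ι hι K).2 h3,
      fun u hu w hwL hwB huw => ?_, ?_⟩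
    · obtain ⟨u, hu', rfl⟩ := Finset.mem_map.1 hu
      exact h2 u hu'
    · obtain ⟨u, hu', rfl⟩ := Finset.mem_map.1 hu
      obtain ⟨w, rfl⟩ := hcl _ _ huw
      exact Finset.mem_map_of_mem _ (h4 u hu' w hwL hwB ((hι _ _).2 huw))
    · simpa [boundary_map ι hι hcl] using h5

/-- No edge leaves the range, so a connected set that meets it stays inside. Thus the selected sets
meeting the range are exactly images of finite sets of `V`. -/
theorem CutConnected.eq_map (hcl : ∀ u w, A' (ι u) w → w ∈ Set.range ι)
    {K : Finset W} (hK : CutConnected A' K) {v : V} (hv : ι v ∈ K) :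
    ∃ K₀ : Finset V, K = K₀.map ι := by
  classical
  refine ⟨K.preimage ι ι.injective.injOn, ?_⟩
  by_contra hne
  have hmem : ∀ x, x ∈ (K.preimage ι ι.injective.injOn).map ι ↔ x ∈ K ∧ x ∈ Set.range ι := by
    intro x
    simp only [Finset.mem_map, Finset.mem_preimage]
    constructor
    · rintro ⟨y, hy, rfl⟩
      exact ⟨hy, y, rfl⟩
    · rintro ⟨hx, y, rfl⟩
      exact ⟨y, hx, rfl⟩
  obtain ⟨u, hu, w, hw, hwT, huw⟩ := hK _ (fun x hx => ((hmem x).1 hx).1)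
    ⟨ι v, (hmem _).2 ⟨hv, v, rfl⟩⟩ (fun e => hne e.symm)
  obtain ⟨-, u, rfl⟩ := (hmem u).1 hu
  exact hwT ((hmem w).2 ⟨hw, hcl _ _ huw⟩)

theorem alive_comp (hι : ∀ u v, A u v ↔ A' (ι u) (ι v))
    (hcl : ∀ u w, A' (ι u) w → w ∈ Set.range ι) (b : ℕ → W → Bool) (n : ℕ) :
    alive A α (fun n v => b n (ι v)) n = ι ⁻¹' alive A' α b n := by
  induction n with
  | zero => rfl
  | succ n ih =>
    ext v
    have hsel : ∀ K, Sel A α (alive A α (fun n v => b n (ι v)) n) {v | b n (ι v) = true} K ↔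
        Sel A' α (alive A' α b n) {v | b n v = true} (K.map ι) := fun K => by
      rw [sel_map ι hι hcl, ih]; rfl
    simp only [alive, Set.mem_ofPred_eq, Set.mem_preimage]
    refine and_congr (by rw [ih]; rfl) ⟨fun h K hK hv => ?_, fun h K hK hv => ?_⟩
    · obtain ⟨K, rfl⟩ := hK.conn.eq_map ι hcl hv
      exact h K ((hsel K).2 hK) (by simpa using hv)
    · exact h _ ((hsel K).1 hK) (Finset.mem_map_of_mem _ hv)

theorem selected_map (hι : ∀ u v, A u v ↔ A' (ι u) (ι v))
    (hcl : ∀ u w, A' (ι u) w → w ∈ Set.range ι) (b : ℕ → W → Bool) (n : ℕ) (K : Finset V) :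
    Selected A' α b n (K.map ι) ↔ Selected A α (fun n v => b n (ι v)) n K := by
  rw [Selected, Selected, sel_map ι hι hcl, alive_comp ι hι hcl]
  rfl

/-- Used for graph isomorphisms, and for the inclusion into `ℕ` of the vertex set of a code. -/
theorem removed_comp (hι : ∀ u v, A u v ↔ A' (ι u) (ι v))
    (hcl : ∀ u w, A' (ι u) w → w ∈ Set.range ι) (b : ℕ → W → Bool) :
    removed A α (fun n v => b n (ι v)) = ι ⁻¹' removed A' α b := by
  ext v
  simp only [removed, Set.mem_ofPred_eq, Set.mem_preimage]
  constructor
  · rintro ⟨n, K, hK, hv⟩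
    refine ⟨n, K.map ι, (selected_map ι hι hcl b n K).2 hK, ?_⟩
    rw [boundary_map ι hι hcl, ← alive_comp ι hι hcl]
    exact Finset.mem_map_of_mem _ hv
  · rintro ⟨n, K, hK, hv⟩
    obtain ⟨K, rfl⟩ := hK.conn.eq_map ι hcl (mem_boundary.1 hv).1
    refine ⟨n, K, (selected_map ι hι hcl b n K).1 hK, ?_⟩
    rw [boundary_map ι hι hcl, ← alive_comp ι hι hcl] at hv
    simpa using hv

theorem expanding_map (hι : ∀ u v, A u v ↔ A' (ι u) (ι v))
    (hcl : ∀ u w, A' (ι u) w → w ∈ Set.range ι) {O : Set W} (hO : O ⊆ Set.range ι) :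
    Expanding A' α O ↔ Expanding A α (ι ⁻¹' O) := by
  classical
  constructor
  · intro h K hK hKO hs
    obtain ⟨F, ⟨u, hu, huF⟩, hF⟩ := h (K.map ι) (by simpa using hK)
      (fun u hu => by
        obtain ⟨u, hu', rfl⟩ := Finset.mem_map.1 hu
        exact hKO u hu') (by simpa [boundary_map ι hι hcl] using hs)
    obtain ⟨u, hu', rfl⟩ := Finset.mem_map.1 hu
    refine ⟨F.preimage ι ι.injective.injOn, ⟨u, hu', by simpa using huF⟩, ?_⟩
    intro u hu huO w hw huw
    rw [Finset.mem_preimage] at hu ⊢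
    exact hF _ hu huO _ hw ((hι _ _).1 huw)
  · intro h K hK hKO hs
    obtain ⟨K, -, rfl⟩ := Finset.subset_map_iff.1
      (show K ⊆ (K.preimage ι ι.injective.injOn).map ι from fun u hu => by
        obtain ⟨v, rfl⟩ := hO (hKO u hu)
        exact Finset.mem_map_of_mem _ (by simpa using hu))
    rw [boundary_map ι hι hcl, Finset.card_map, Finset.card_map] at hs
    obtain ⟨F, ⟨u, hu, huF⟩, hF⟩ := h K (by simpa using hK)
      (fun u hu => hKO _ (Finset.mem_map_of_mem _ hu)) hs
    refine ⟨F.map ι, ⟨ι u, Finset.mem_map_of_mem _ hu, Finset.mem_map_of_mem _ huF⟩, ?_⟩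
    intro x hx hxO w hw hxw
    obtain ⟨x, hx', rfl⟩ := Finset.mem_map.1 hx
    obtain ⟨w, rfl⟩ := hcl _ _ hxw
    exact Finset.mem_map_of_mem _ (hF x hx' hxO w hw ((hι _ _).2 hxw))

end Naturality

/-! ### From `Expanding` to the expansion constant -/

section Expansion

/-- A set violating the bound would meet a finite `F` that is closed under adjacency in `O`.
Following walks, `F` would contain all of `C`, which is infinite. -/
theorem Expanding.le_innerVertexExpansionConstant {U : Type*} {H : SimpleGraph U}
    {A : V → V → Prop} {α : ℝ} {O : Set V} (h : Expanding A α O) (j : U ↪ V) (hj : ∀ u, j u ∈ O)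
    (hadj : ∀ u v, H.Adj u v ↔ A (j u) (j v)) (hcl : ∀ u, ∀ w ∈ O, A (j u) w → ∃ v, j v = w)
    (C : H.ConnectedComponent) (hC : C.supp.Infinite) :
    α ≤ C.toSimpleGraph.innerVertexExpansionConstant := by
  classical
  obtain ⟨x, hx⟩ := hC.nonempty
  have : Nonempty {K : Finset C // K.Nonempty} := ⟨⟨{⟨x, hx⟩}, Finset.singleton_nonempty _⟩⟩
  refine le_ciInf ?_
  rintro ⟨K, hK⟩
  by_contra! hlt
  have hpos : (0 : ℝ) < K.card := by exact_mod_cast hK.card_pos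
  rw [div_lt_iff₀ hpos] at hlt
  let e : C ↪ V := (Function.Embedding.subtype _).trans j
  have hB : (C.toSimpleGraph.innerBoundary K).Finite := K.finite_toSet.subset fun u hu => hu.1
  have hsub : boundary A O (K.map e) ⊆ hB.toFinset.map e := by
    intro u' hu'
    obtain ⟨hu, w, hwO, hw, huw⟩ := mem_boundary.1 hu'
    obtain ⟨u, huK, rfl⟩ := Finset.mem_map.1 hu
    obtain ⟨v, rfl⟩ := hcl u.1 w hwO huw
    have huv : H.Adj u.1 v := (hadj _ _).2 huw
    have hv : v ∈ C := (C.mem_supp_congr_adj huv).1 u.2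
    refine Finset.mem_map_of_mem _ (hB.mem_toFinset.2 ⟨huK, ⟨v, hv⟩, fun hvK => hw ?_, huv⟩)
    exact Finset.mem_map_of_mem e hvK
  have hcard := Finset.card_le_card hsub
  rw [Finset.card_map, ← Set.ncard_eq_toFinset_card _ hB] at hcard
  obtain ⟨F, ⟨u', hu', huF⟩, hF⟩ := h (K.map e) (by simpa using hK) (fun u hu => by
    obtain ⟨u, -, rfl⟩ := Finset.mem_map.1 hu
    exact hj _) (by
      rw [Finset.card_map]
      exact lt_of_le_of_lt (by exact_mod_cast hcard) hlt)
  obtain ⟨u, hu, rfl⟩ := Finset.mem_map.1 hu'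
  have hall : ∀ y : C, e y ∈ F := by
    intro y
    obtain ⟨q⟩ := C.connected_toSimpleGraph.preconnected u y
    clear hu hu'
    induction q with
    | nil => exact huF
    | cons hadj' _ ih => exact ih (hF _ huF (hj _) _ (hj _) ((hadj _ _).1 hadj'))
  have : Finite C := Finite.of_injective (fun y : C => (⟨e y, hall y⟩ : F))
    fun y z hyz => e.injective (congrArg Subtype.val hyz)
  exact hC (Set.toFinite (C.supp))

end Expansion

/-! ### The mass transport between selected sets and their boundaries -/

section Charge

open Classical in
/-- Every vertex of a selected set `K` sends mass `1 / |K|` to every vertex of the boundary of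
`K`. -/
noncomputable def charge (A : V → V → Prop) (α : ℝ) (b : ℕ → V → Bool) (u v : V) : ℝ≥0∞ :=
  ∑' p : ℕ × Finset V, if Selected A α b p.1 p.2 ∧ u ∈ p.2 ∧ v ∈ boundary A (alive A α b p.1) p.2
    then (p.2.card : ℝ≥0∞)⁻¹ else 0

theorem charge_comp {A : V → V → Prop} {A' : W → W → Prop} {α : ℝ} (ι : V ↪ W)
    (hι : ∀ u v, A u v ↔ A' (ι u) (ι v))
    (hcl : ∀ u w, A' (ι u) w → w ∈ Set.range ι) (b : ℕ → W → Bool) (u v : V) :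
    charge A α (fun n v => b n (ι v)) u v = charge A' α b (ι u) (ι v) := by
  classical
  have hinj : Function.Injective fun p : ℕ × Finset V => (p.1, p.2.map ι) := by
    rintro ⟨n, K⟩ ⟨m, K'⟩ h
    simp only [Prod.mk.injEq, Finset.map_inj] at h
    simp [h]
  rw [charge, charge, ← hinj.tsum_eq]
  · refine tsum_congr fun p => ?_
    simp only [selected_map ι hι hcl, boundary_map ι hι hcl, alive_comp ι hι hcl,
      Finset.mem_map', Finset.card_map]
  · rintro ⟨n, K⟩ hp
    simp only [Function.mem_support, ne_eq, ite_eq_right_iff, not_forall] at hp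
    obtain ⟨⟨hK, hu, -⟩, -⟩ := hp
    obtain ⟨K, rfl⟩ := hK.conn.eq_map ι hcl hu
    exact ⟨(n, K), rfl⟩

variable {A : V → V → Prop} {α : ℝ} {b : ℕ → V → Bool}

/-- Only the unique selected `K` containing `u` contributes, and it gives `|∂K| / |K| < α`. -/
theorem tsum_charge_le (hα : 0 ≤ α) (u : V) : ∑' v, charge A α b u v ≤ ENNReal.ofReal α := by
  classical
  simp only [charge]
  rw [ENNReal.tsum_comm]
  by_cases hu : ∃ n K, Selected A α b n K ∧ u ∈ K
  · obtain ⟨n, K, hK, hu⟩ := hu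
    rw [tsum_eq_single (n, K)]
    · have hsum : ∑' v, (if Selected A α b n K ∧ u ∈ K ∧ v ∈ boundary A (alive A α b n) K
          then (K.card : ℝ≥0∞)⁻¹ else 0) =
          ∑ v ∈ boundary A (alive A α b n) K, (K.card : ℝ≥0∞)⁻¹ := by
        rw [tsum_eq_sum (s := boundary A (alive A α b n) K)]
        · exact Finset.sum_congr rfl fun v hv => if_pos ⟨hK, hu, hv⟩
        · exact fun v hv => if_neg fun h => hv h.2.2
      rw [hsum, Finset.sum_const, nsmul_eq_mul, ← div_eq_mul_inv]
      have hpos : (K.card : ℝ≥0∞) ≠ 0 := by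
        exact_mod_cast Finset.card_ne_zero_of_mem hu
      rw [ENNReal.div_le_iff hpos (ENNReal.natCast_ne_top _), ← ENNReal.ofReal_natCast,
        ← ENNReal.ofReal_natCast, ← ENNReal.ofReal_mul hα]
      exact ENNReal.ofReal_le_ofReal hK.small.le
    · rintro ⟨m, K'⟩ hne
      refine ENNReal.tsum_eq_zero.2 fun v => if_neg ?_
      rintro ⟨hK', hu', -⟩
      obtain ⟨rfl, rfl⟩ := hK.unique hK' hu hu'
      exact hne rfl
  · push Not at hu
    have : ∀ p : ℕ × Finset V, ∑' v, (if Selected A α b p.1 p.2 ∧ u ∈ p.2 ∧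
        v ∈ boundary A (alive A α b p.1) p.2 then (p.2.card : ℝ≥0∞)⁻¹ else 0) = 0 := fun p =>
      ENNReal.tsum_eq_zero.2 fun v => if_neg fun h => hu p.1 p.2 h.1 h.2.1
    simp [this]

/-- The `|K|` vertices of a selected set with `v` in its boundary send `1 / |K|` each. -/
theorem one_le_tsum_charge {v : V} (hv : v ∈ removed A α b) : 1 ≤ ∑' u, charge A α b u v := by
  classical
  obtain ⟨n, K, hK, hv⟩ := hv
  have hpos : (K.card : ℝ≥0∞) ≠ 0 := by
    exact_mod_cast Finset.card_ne_zero_of_mem (mem_boundary.1 hv).1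
  calc (1 : ℝ≥0∞) = ∑ u ∈ K, (K.card : ℝ≥0∞)⁻¹ := by
        rw [Finset.sum_const, nsmul_eq_mul, ENNReal.mul_inv_cancel hpos (ENNReal.natCast_ne_top _)]
    _ ≤ ∑ u ∈ K, charge A α b u v := by
        refine Finset.sum_le_sum fun u hu => ?_
        refine le_trans (le_of_eq ?_) (ENNReal.le_tsum (n, K))
        exact (if_pos ⟨hK, hu, hv⟩).symm
    _ ≤ _ := ENNReal.sum_le_tsum _

end Charge

/-! ### Joint measurability in the graph and the coins -/

section Measurability

variable {Ω : Type*} [MeasurableSpace Ω] [Countable V] {α : ℝ} {A : Ω → V → V → Prop}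

theorem measurable_mem_boundary {L : Ω → Set V}
    (hA : ∀ u v, Measurable fun p => A p u v) (hL : ∀ v, Measurable fun p => v ∈ L p)
    (K : Finset V) (u : V) : Measurable fun p => u ∈ boundary (A p) (L p) K := by
  simp only [mem_boundary]
  fun_prop

theorem measurable_card_boundary {L : Ω → Set V}
    (hA : ∀ u v, Measurable fun p => A p u v) (hL : ∀ v, Measurable fun p => v ∈ L p)
    (K : Finset V) : Measurable fun p => ((boundary (A p) (L p) K).card : ℝ) := by
  classical
  have : (fun p => ((boundary (A p) (L p) K).card : ℝ)) =
      fun p => ∑ u ∈ K, if u ∈ boundary (A p) (L p) K then (1 : ℝ) else 0 := by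
    funext p
    rw [Finset.sum_ite_mem, Finset.inter_eq_right.2 fun u hu => (mem_boundary.1 hu).1]
    simp
  rw [this]
  exact Finset.measurable_sum _ fun u _ => Measurable.ite
    (measurable_mem_boundary hA hL K u).setOf measurable_const measurable_const

theorem measurable_card_boundary_lt {L : Ω → Set V}
    (hA : ∀ u v, Measurable fun p => A p u v) (hL : ∀ v, Measurable fun p => v ∈ L p)
    (K : Finset V) : Measurable fun p => ((boundary (A p) (L p) K).card : ℝ) < α * K.card :=
  measurableSet_setOfPred.1 (measurableSet_lt (measurable_card_boundary hA hL K) measurable_const)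

theorem measurable_sel {L B : Ω → Set V}
    (hA : ∀ u v, Measurable fun p => A p u v) (hL : ∀ v, Measurable fun p => v ∈ L p)
    (hB : ∀ v, Measurable fun p => v ∈ B p) (K : Finset V) :
    Measurable fun p => Sel (A p) α (L p) (B p) K := by
  have : (fun p => Sel (A p) α (L p) (B p) K) = fun p => K.Nonempty ∧
      (∀ u ∈ K, u ∈ L p ∧ u ∈ B p) ∧ CutConnected (A p) K ∧
      (∀ u ∈ K, ∀ w, w ∈ L p → w ∈ B p → A p u w → w ∈ K) ∧
      ((boundary (A p) (L p) K).card : ℝ) < α * K.card := by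
    ext p
    exact ⟨fun h => ⟨h.1, h.2, h.3, h.4, h.5⟩, fun ⟨h1, h2, h3, h4, h5⟩ => ⟨h1, h2, h3, h4, h5⟩⟩
  rw [this]
  have h1 := measurable_card_boundary_lt (α := α) hA hL K
  unfold CutConnected
  fun_prop

variable {b : Ω → ℕ → V → Bool}

theorem measurable_mem_alive (hA : ∀ u v, Measurable fun p => A p u v)
    (hb : ∀ n v, Measurable fun p => b p n v) (n : ℕ) (v : V) :
    Measurable fun p => v ∈ alive (A p) α (b p) n := by
  induction n generalizing v with
  | zero => exact measurable_const
  | succ n ih =>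
    have h := fun K => measurable_sel (α := α) (B := fun p => {v | b p n v = true}) hA ih
      (fun v => (hb n v).eq_const true) K
    simp only [alive, Set.mem_ofPred_eq]
    exact (ih v).and (.forall fun K => (h K).imp measurable_const)

theorem measurable_selected (hA : ∀ u v, Measurable fun p => A p u v)
    (hb : ∀ n v, Measurable fun p => b p n v) (n : ℕ) (K : Finset V) :
    Measurable fun p => Selected (A p) α (b p) n K :=
  measurable_sel hA (measurable_mem_alive hA hb n) (fun v => (hb n v).eq_const true) K

theorem measurable_mem_removed (hA : ∀ u v, Measurable fun p => A p u v)
    (hb : ∀ n v, Measurable fun p => b p n v) (v : V) :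
    Measurable fun p => v ∈ removed (A p) α (b p) :=
  .exists fun n => .exists fun K => (measurable_selected hA hb n K).and
    (measurable_mem_boundary hA (measurable_mem_alive hA hb n) K v)

theorem measurable_charge (hA : ∀ u v, Measurable fun p => A p u v)
    (hb : ∀ n v, Measurable fun p => b p n v) (u v : V) :
    Measurable fun p => charge (A p) α (b p) u v := by
  classical
  unfold charge
  refine Measurable.tsum fun q => ?_
  exact Measurable.ite ((measurable_selected hA hb q.1 q.2).and (measurable_const.and
    (measurable_mem_boundary hA (measurable_mem_alive hA hb q.1) q.2 v))).setOf
    measurable_const measurable_const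

theorem measurable_expanding {O : Ω → Set V} (hA : ∀ u v, Measurable fun p => A p u v)
    (hO : ∀ v, Measurable fun p => v ∈ O p) : Measurable fun p => Expanding (A p) α (O p) := by
  have h := fun K => measurable_card_boundary_lt (α := α) hA hO K
  unfold Expanding
  fun_prop

end Measurability

/-! ### Independent coins -/

section Randomness

open Measure

/-- The law of a fair coin. -/
noncomputable def coin : Measure Bool := (PMF.uniformOfFintype Bool).toMeasure

instance : IsProbabilityMeasure coin := by unfold coin; infer_instance

theorem coin_singleton (x : Bool) : coin {x} = 2⁻¹ := by
  rw [coin, PMF.toMeasure_apply_singleton _ _ (measurableSet_singleton _)]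
  simp

variable (V) in
/-- The law of independent fair coins for all times and vertices. -/
noncomputable def coins : Measure (ℕ → V → Bool) := infinitePi fun _ => infinitePi fun _ => coin

instance : IsProbabilityMeasure (coins V) := by unfold coins; infer_instance

theorem coins_map (ι : V ↪ W) :
    (coins W).map (fun b n v => b n (ι v)) = coins V := by
  rw [coins, infinitePi_map_pi (f := fun _ (x : W → Bool) v => x (ι v)) _ (fun _ => by fun_prop)]
  simp only [map_infinitePi_infinitePi_of_inj (P := fun _ : W => coin) ι.injective]
  rfl

/-- For fixed `S` and `T` the pattern has the same positive probability at every time, independently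
over times, so the second Borel–Cantelli lemma applies. There are only countably many pairs. -/
theorem ae_generic [Countable V] : ∀ᵐ b ∂coins V, Generic b := by
  classical
  simp only [Generic]
  refine ae_all_iff.2 fun S => ae_all_iff.2 fun T => ?_
  suffices h : Disjoint S T → ∀ᵐ b ∂coins V, ∃ᶠ n in Filter.atTop,
      (∀ v ∈ S, b n v = true) ∧ ∀ v ∈ T, b n v = false by
    by_cases hST : Disjoint S T
    · filter_upwards [h hST] with b hb n₀ _
      obtain ⟨n, hn, h⟩ := Filter.frequently_atTop.1 hb n₀
      exact ⟨n, hn, h⟩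
    · exact .of_forall fun b n₀ h => absurd h hST
  intro hST
  let t : V → Set Bool := fun v => if v ∈ S then {true} else {false}
  let E : Set (V → Bool) := ((S ∪ T : Finset V) : Set V).pi t
  have hE : MeasurableSet E := .pi (Finset.countable_toSet _) fun _ _ => .of_discrete
  have hEpos : infinitePi (fun _ : V => coin) E ≠ 0 := by
    rw [infinitePi_pi _ fun _ _ => .of_discrete, Finset.prod_ne_zero_iff]
    intro v _
    simp only [t]
    split_ifs <;> simp [coin_singleton]
  let s : ℕ → Set (ℕ → V → Bool) := fun n => (fun b => b n) ⁻¹' E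
  have hs : ∀ n, MeasurableSet (s n) := fun n => measurable_pi_apply n hE
  have hind : ProbabilityTheory.iIndepSet s (coins V) := by
    have h := (ProbabilityTheory.iIndepFun_infinitePi (P := fun _ : ℕ => infinitePi fun _ : V => coin)
      (X := fun _ x => x) (fun _ => measurable_id))
    rw [ProbabilityTheory.iIndepSet_iff_meas_biInter hs]
    exact fun I => h.measure_inter_preimage_eq_mul I fun _ _ => hE
  have hlim := ProbabilityTheory.measure_limsup_eq_one hs hind (by
    have : ∀ n, coins V (s n) = infinitePi (fun _ : V => coin) E := fun n =>
      (measurePreserving_eval_infinitePi (fun _ : ℕ => infinitePi fun _ : V => coin)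
        n).measure_preimage hE.nullMeasurableSet
    rw [tsum_congr this]
    exact ENNReal.tsum_const_eq_top_of_ne_zero hEpos)
  have hmem : Filter.limsup s Filter.atTop ∈ ae (coins V) :=
    mem_ae_iff.2 ((prob_compl_eq_zero_iff (.measurableSet_limsup hs)).2 hlim)
  filter_upwards [hmem] with b hb
  rw [Filter.mem_limsup_iff_frequently_mem] at hb
  refine hb.mono fun n hn => ⟨fun v hv => ?_, fun v hv => ?_⟩
  · simpa [t, hv] using hn v (by simp [hv])
  · simpa [t, Finset.disjoint_right.1 hST hv] using hn v (by simp [hv])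

end Randomness

end Thinning

/-! ## The space of marked graphs is second countable and `T0` -/

namespace LocalGraph

open GraphSpace

theorem dist_le_succ_iff {V : Type*} {G : SimpleGraph V} (hG : G.Connected) {u v : V} {n : ℕ} :
    G.dist u v ≤ n + 1 ↔ G.dist u v ≤ n ∨ ∃ w, G.dist u w ≤ n ∧ G.Adj w v := by
  constructor
  · intro h
    -- The geodesic starts at `v`, so that its first edge is the edge at `v`.
    obtain ⟨p, hp⟩ := hG.exists_walk_length_eq_dist v u
    rw [G.dist_comm] at hp
    cases p with
    | nil => exact Or.inl (by simp)
    | @cons _ w _ hvw q =>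
      refine Or.inr ⟨w, ?_, hvw.symm⟩
      rw [SimpleGraph.Walk.length_cons] at hp
      rw [G.dist_comm]
      exact (SimpleGraph.dist_le q).trans (by omega)
  · rintro (h | ⟨w, hw, hwv⟩)
    · omega
    · have h1 := hG.dist_triangle (u := u) (v := w) (w := v)
      rw [SimpleGraph.dist_eq_one_iff_adj.2 hwv] at h1
      omega

theorem finite_dist_le {V : Type*} {G : SimpleGraph V} (hG : G.Connected)
    (hfin : ∀ v, (G.neighborSet v).Finite) (u : V) (n : ℕ) : {v | G.dist u v ≤ n}.Finite := by
  induction n with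
  | zero =>
    refine (Set.finite_singleton u).subset fun v hv => ?_
    exact (hG.dist_eq_zero_iff.1 (Nat.le_zero.1 hv)).symm
  | succ n ih =>
    refine (ih.union (ih.biUnion fun w _ => hfin w)).subset fun v hv => ?_
    rcases (dist_le_succ_iff hG).1 hv with h | ⟨w, hw, hwv⟩
    · exact Or.inl h
    · exact Or.inr (Set.mem_biUnion (show w ∈ {v | G.dist u v ≤ n} from hw) hwv)

namespace MarkedGraph

variable {k : ℕ} {X : Type}

theorem finite_ball (G : MarkedGraph k X) (r : ℕ) : (G.ball r).Finite := by
  have : G.ball r = ⋃ i, {v | G.graph.dist (G.root i) v ≤ r} := by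
    ext v
    simp [ball]
  rw [this]
  exact Set.finite_iUnion fun i => finite_dist_le G.connected G.locallyFinite _ _

instance (G : MarkedGraph k X) : Countable G.V := by
  obtain ⟨u⟩ := G.connected.nonempty
  rw [← Set.countable_univ_iff]
  refine (Set.countable_iUnion fun n =>
    (finite_dist_le G.connected G.locallyFinite u n).countable).mono fun v _ => ?_
  exact Set.mem_iUnion.2 ⟨G.graph.dist u v, le_refl (G.graph.dist u v)⟩

/-- A finite rooted marked graph on an initial segment of the natural numbers. -/
abbrev Pattern (k : ℕ) (X : Type) : Type :=
  (n : ℕ) × (Fin n → Fin n → Bool) × (Fin k → Fin n) × (Fin n → X) × (Fin n → Fin n → X)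

/-- The map `f` identifies the finite graph `c` with the ball of radius `r` around the roots. -/
structure IsPattern (G : MarkedGraph k X) (r : ℕ) (c : Pattern k X) (f : Fin c.1 → G.V) :
    Prop where
  injective : Function.Injective f
  mem_ball : ∀ v, v ∈ G.ball r ↔ ∃ i, f i = v
  adj : ∀ i j, G.graph.Adj (f i) (f j) ↔ c.2.1 i j = true
  root : ∀ i, f (c.2.2.1 i) = G.root i
  vmark : ∀ i, G.vmark (f i) = c.2.2.2.1 i
  emark : ∀ i j, G.graph.Adj (f i) (f j) → G.emark s(f i, f j) = c.2.2.2.2 i j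

theorem exists_isPattern (G : MarkedGraph k X) (r : ℕ) : ∃ c f, G.IsPattern r c f := by
  classical
  have := (G.finite_ball r).to_subtype
  obtain ⟨n, ⟨e⟩⟩ := Finite.exists_equiv_fin (G.ball r)
  refine ⟨⟨n, fun i j => decide (G.graph.Adj (e.symm i) (e.symm j)),
    fun i => e ⟨G.root i, G.root_mem_ball r i⟩, fun i => G.vmark (e.symm i),
    fun i j => G.emark s((e.symm i : G.V), (e.symm j : G.V))⟩, fun i => e.symm i, ?_⟩
  refine ⟨fun i j h => e.symm.injective (Subtype.ext h), fun v => ⟨fun h => ⟨e ⟨v, h⟩, by simp⟩, ?_⟩,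
    by simp, by simp, by simp, by simp⟩
  rintro ⟨i, rfl⟩
  exact (e.symm i).2

/-- With `IsPattern.locallyIsomorphic`, this turns local isomorphism into having a common pattern.
For countable `X` there are countably many patterns, whence second countability. -/
theorem LocallyIsomorphic.isPattern {G H : MarkedGraph k X} {r : ℕ}
    (h : G.LocallyIsomorphic r H) {c : Pattern k X} {f : Fin c.1 → G.V} (hf : G.IsPattern r c f) :
    ∃ g, H.IsPattern r c g := by
  obtain ⟨φ, h1, h2, h3⟩ := h
  have hmem : ∀ i, f i ∈ G.ball r := fun i => (hf.mem_ball _).2 ⟨i, rfl⟩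
  have hadj : ∀ i j, H.graph.Adj (φ ⟨f i, hmem i⟩) (φ ⟨f j, hmem j⟩) ↔ G.graph.Adj (f i) (f j) :=
    fun i j => φ.map_rel_iff (a := ⟨f i, hmem i⟩) (b := ⟨f j, hmem j⟩)
  refine ⟨fun i => φ ⟨f i, hmem i⟩, fun i j h => ?_, fun v => ⟨fun hv => ?_, ?_⟩,
    fun i j => (hadj i j).trans (hf.adj i j), fun i => ?_, fun i => ?_, fun i j h => ?_⟩
  · exact hf.injective (congrArg Subtype.val (φ.injective (Subtype.ext h)))
  · obtain ⟨i, hi⟩ := (hf.mem_ball _).1 (φ.symm ⟨v, hv⟩).2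
    refine ⟨i, ?_⟩
    simp only [hi, Subtype.coe_eta]
    exact congrArg Subtype.val (φ.apply_symm_apply ⟨v, hv⟩)
  · rintro ⟨i, rfl⟩
    exact (φ ⟨f i, hmem i⟩).2
  · refine Eq.trans ?_ (congrArg Subtype.val (h1 i))
    simp only [hf.root]
  · exact (h2 _).trans (hf.vmark i)
  · exact (h3 ⟨f i, hmem i⟩ ⟨f j, hmem j⟩ ((hadj i j).1 h)).trans (hf.emark i j ((hadj i j).1 h))

theorem IsPattern.locallyIsomorphic {G H : MarkedGraph k X} {r : ℕ} {c : Pattern k X}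
    {f : Fin c.1 → G.V} {g : Fin c.1 → H.V} (hf : G.IsPattern r c f) (hg : H.IsPattern r c g) :
    G.LocallyIsomorphic r H := by
  let e : Fin c.1 ≃ G.ball r := Equiv.ofBijective (fun i => ⟨f i, (hf.mem_ball _).2 ⟨i, rfl⟩⟩)
    ⟨fun i j h => hf.injective (congrArg Subtype.val h), fun v => by
      obtain ⟨i, hi⟩ := (hf.mem_ball _).1 v.2
      exact ⟨i, Subtype.ext hi⟩⟩
  let e' : Fin c.1 ≃ H.ball r := Equiv.ofBijective (fun i => ⟨g i, (hg.mem_ball _).2 ⟨i, rfl⟩⟩)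
    ⟨fun i j h => hg.injective (congrArg Subtype.val h), fun v => by
      obtain ⟨i, hi⟩ := (hg.mem_ball _).1 v.2
      exact ⟨i, Subtype.ext hi⟩⟩
  have he : ∀ i, ((e i : G.ball r) : G.V) = f i := fun i => rfl
  have he' : ∀ i, ((e' i : H.ball r) : H.V) = g i := fun i => rfl
  refine ⟨⟨e.symm.trans e', fun {u v} => ?_⟩, fun i => ?_, fun v => ?_, fun u v => ?_⟩
  · obtain ⟨i, rfl⟩ := e.surjective u
    obtain ⟨j, rfl⟩ := e.surjective v
    simp only [Equiv.trans_apply, Equiv.symm_apply_apply, SimpleGraph.comap_adj,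
      Function.Embedding.subtype_apply, he, he']
    rw [hf.adj, hg.adj]
  · have : (⟨G.root i, G.root_mem_ball r i⟩ : G.ball r) = e (c.2.2.1 i) :=
      Subtype.ext (hf.root i).symm
    rw [this]
    refine Subtype.ext ?_
    simp only [RelIso.coe_fn_mk, Equiv.trans_apply, Equiv.symm_apply_apply, he']
    exact hg.root i
  · obtain ⟨i, rfl⟩ := e.surjective v
    simp only [RelIso.coe_fn_mk, Equiv.trans_apply, Equiv.symm_apply_apply, he, he']
    rw [hf.vmark, hg.vmark]
  · obtain ⟨i, rfl⟩ := e.surjective u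
    obtain ⟨j, rfl⟩ := e.surjective v
    simp only [RelIso.coe_fn_mk, Equiv.trans_apply, Equiv.symm_apply_apply, he, he']
    intro h
    rw [hf.emark _ _ h, hg.emark _ _ ((hg.adj i j).2 ((hf.adj i j).1 h))]

theorem Isomorphic.locallyIsomorphic {G H : MarkedGraph k X} (h : G.Isomorphic H) (r : ℕ) :
    G.LocallyIsomorphic r H := by
  obtain ⟨φ, h1, h2, h3⟩ := h
  have hd : ∀ u v, H.graph.dist (φ u) (φ v) = G.graph.dist u v := by
    intro u v
    refine le_antisymm ?_ ?_
    · obtain ⟨p, hp⟩ := G.connected.exists_walk_length_eq_dist u v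
      rw [← hp, ← SimpleGraph.Walk.length_map φ.toHom p]
      exact SimpleGraph.dist_le _
    · obtain ⟨p, hp⟩ := H.connected.exists_walk_length_eq_dist (φ u) (φ v)
      rw [← hp, ← SimpleGraph.Walk.length_map φ.symm.toHom p]
      have := SimpleGraph.dist_le (p.map φ.symm.toHom)
      simpa using this
  have hb : ∀ v, v ∈ G.ball r ↔ φ v ∈ H.ball r := fun v => by
    simp only [ball, Set.mem_ofPred_eq, ← h1, hd]
  exact ⟨⟨φ.toEquiv.subtypeEquiv hb, fun {u v} => φ.map_rel_iff⟩, fun i => Subtype.ext (h1 i),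
    fun v => h2 v, fun u v h => h3 u v h⟩

/-- A pattern that is common to two graphs preserves the distances to the roots. -/
theorem IsPattern.dist_le {G H : MarkedGraph k X} {r : ℕ} {c : Pattern k X}
    {f : Fin c.1 → G.V} {g : Fin c.1 → H.V} (hf : G.IsPattern r c f) (hg : H.IsPattern r c g)
    {j : Fin k} {s : ℕ} (hs : s ≤ r) {i : Fin c.1} (h : G.graph.dist (G.root j) (f i) ≤ s) :
    H.graph.dist (H.root j) (g i) ≤ s := by
  induction s generalizing i with
  | zero =>
    have h0 := G.connected.dist_eq_zero_iff.1 (Nat.le_zero.1 h)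
    rw [← hf.root] at h0
    rw [← hg.root, hf.injective h0]
    simp
  | succ s ih =>
    rcases (dist_le_succ_iff G.connected).1 h with h | ⟨w, hw, hadj⟩
    · exact (ih (by omega) h).trans (by omega)
    -- The predecessor on a geodesic is still in the ball, so the pattern sees the last edge.
    · obtain ⟨i', rfl⟩ := (hf.mem_ball w).1 ⟨j, hw.trans (by omega)⟩
      exact (dist_le_succ_iff H.connected).2
        (Or.inr ⟨g i', ih (by omega) hw, (hg.adj _ _).2 ((hf.adj _ _).1 hadj)⟩)

/-- The vertices `v` and `w` correspond to each other under identifications with common patterns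
for almost all radii, with respect to an ultrafilter. -/
def LimitRel (G H : MarkedGraph k X) (c : ℕ → Pattern k X) (f : ∀ r, Fin (c r).1 → G.V)
    (g : ∀ r, Fin (c r).1 → H.V) (v : G.V) (w : H.V) : Prop :=
  ∀ᶠ r in (Filter.hyperfilter ℕ : Filter ℕ), ∃ i, f r i = v ∧ g r i = w

/-- For large radii the partner of `v` stays in one finite ball of `H`, since patterns preserve
distances to the root; the ultrafilter singles out one partner. -/
theorem exists_limitRel [NeZero k] {G H : MarkedGraph k X} {c : ℕ → Pattern k X}
    {f : ∀ r, Fin (c r).1 → G.V} {g : ∀ r, Fin (c r).1 → H.V} (hf : ∀ r, G.IsPattern r (c r) (f r))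
    (hg : ∀ r, H.IsPattern r (c r) (g r)) (v : G.V) : ∃ w, LimitRel G H c f g v w := by
  set s := G.graph.dist (G.root 0) v with hs
  have hfin := H.finite_ball s
  have hev : ∀ᶠ r in (Filter.hyperfilter ℕ : Filter ℕ),
      r ∈ ⋃ w ∈ H.ball s, {r | ∃ i, f r i = v ∧ g r i = w} := by
    have h1 : ∀ᶠ r in (Filter.hyperfilter ℕ : Filter ℕ), s ≤ r :=
      Nat.hyperfilter_le_atTop (Filter.eventually_ge_atTop s)
    filter_upwards [h1] with r hr
    obtain ⟨i, hi⟩ := ((hf r).mem_ball v).1 ⟨0, hr⟩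
    have := (hf r).dist_le (hg r) (j := 0) hr (i := i) (by rw [hi])
    exact Set.mem_biUnion (x := g r i) ⟨0, this⟩ ⟨i, hi, rfl⟩
  obtain ⟨w, -, hw⟩ := (Ultrafilter.finite_biUnion_mem_iff hfin).1 hev
  exact ⟨w, hw⟩

/-- The identifications at different radii need not be compatible, so their ultrafilter limit is
taken. Any two limit relations hold at a common radius, where the pattern gives injectivity,
adjacency and marks. -/
theorem isomorphic_of_forall_isPattern [NeZero k] {G H : MarkedGraph k X}
    (h : ∀ r, ∃ c f g, G.IsPattern r c f ∧ H.IsPattern r c g) : G.Isomorphic H := by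
  choose c f g hf hg using h
  have hsymm : ∀ v w, LimitRel G H c f g v w ↔ LimitRel H G c g f w v := fun v w => by
    simp only [LimitRel, and_comm]
  choose φ hφ using exists_limitRel hf hg
  choose ψ hψ using exists_limitRel hg hf
  have huniq : ∀ v w w', LimitRel G H c f g v w → LimitRel G H c f g v w' → w = w' := by
    intro v w w' h h'
    obtain ⟨r, ⟨i, hi, rfl⟩, j, hj, rfl⟩ := (h.and h').exists
    rw [(hf r).injective (hi.trans hj.symm)]
  have huniq' : ∀ v w w', LimitRel H G c g f v w → LimitRel H G c g f v w' → w = w' := by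
    intro v w w' h h'
    obtain ⟨r, ⟨i, hi, rfl⟩, j, hj, rfl⟩ := (h.and h').exists
    rw [(hg r).injective (hi.trans hj.symm)]
  let e : G.V ≃ H.V :=
    { toFun := φ
      invFun := ψ
      left_inv := fun v => huniq' _ _ _ (hψ _) ((hsymm _ _).1 (hφ v))
      right_inv := fun w => huniq _ _ _ (hφ _) ((hsymm _ _).2 (hψ w)) }
  have hadj : ∀ u v, H.graph.Adj (φ u) (φ v) ↔ G.graph.Adj u v := by
    intro u v
    obtain ⟨r, ⟨i, hi, hi'⟩, j, hj, hj'⟩ := ((hφ u).and (hφ v)).exists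
    rw [← hi', ← hj', ← hi, ← hj, (hf r).adj, (hg r).adj]
  refine ⟨⟨e, fun {u v} => hadj u v⟩, fun i => ?_, fun v => ?_, fun u v huv => ?_⟩
  · obtain ⟨r, j, hj, hj'⟩ := (hφ (G.root i)).exists
    rw [← (hf r).root] at hj
    rw [← (hg r).root, ← (hf r).injective hj]
    exact hj'.symm
  · obtain ⟨r, i, hi, hi'⟩ := (hφ v).exists
    change H.vmark (φ v) = _
    rw [← hi', ← hi, (hf r).vmark, (hg r).vmark]
  · obtain ⟨r, ⟨i, hi, hi'⟩, j, hj, hj'⟩ := ((hφ u).and (hφ v)).exists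
    have h1 := (hadj u v).2 huv
    change H.emark s(φ u, φ v) = _
    rw [← hi', ← hj'] at h1 ⊢
    rw [← hi, ← hj] at huv ⊢
    rw [(hf r).emark _ _ huv, (hg r).emark _ _ h1]

end MarkedGraph

namespace GraphSpace

variable {k : ℕ} {X : Type}

/-- The set of graphs whose ball of radius `r` is given by the pattern `c`. -/
def cylinder (r : ℕ) (c : MarkedGraph.Pattern k X) : Set (GraphSpace k X) :=
  mk '' {H | ∃ f, H.IsPattern r c f}

theorem mk_mem_cylinder {r : ℕ} {c : MarkedGraph.Pattern k X} {G : MarkedGraph k X} :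
    mk G ∈ cylinder r c ↔ ∃ f, G.IsPattern r c f := by
  constructor
  · rintro ⟨H, ⟨f, hf⟩, h⟩
    exact (MarkedGraph.Isomorphic.locallyIsomorphic (Quotient.exact h) r).isPattern hf
  · exact fun h => ⟨G, h, rfl⟩

theorem image_locallyIsomorphic {r : ℕ} {G : MarkedGraph k X} {c : MarkedGraph.Pattern k X}
    {f : Fin c.1 → G.V} (hf : G.IsPattern r c f) :
    mk '' {H | G.LocallyIsomorphic r H} = cylinder r c := by
  refine congrArg _ (Set.ext fun H => ⟨fun h => h.isPattern hf, ?_⟩)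
  rintro ⟨g, hg⟩
  exact hf.locallyIsomorphic hg

theorem countable_basis_sets [Countable X] :
    {U : Set (GraphSpace k X) | ∃ (r : ℕ) (G : MarkedGraph k X),
      U = mk '' {H | G.LocallyIsomorphic r H}}.Countable := by
  refine (Set.countable_range fun p : ℕ × MarkedGraph.Pattern k X => cylinder p.1 p.2).mono ?_
  rintro U ⟨r, G, rfl⟩
  obtain ⟨c, f, hf⟩ := G.exists_isPattern r
  exact ⟨(r, c), (image_locallyIsomorphic hf).symm⟩

instance [Countable X] : SecondCountableTopology (GraphSpace k X) :=
  ⟨⟨_, countable_basis_sets, rfl⟩⟩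

/-- Inseparable classes lie in the same cylinders, hence share patterns of all radii. -/
instance [NeZero k] : T0Space (GraphSpace k X) := by
  refine ⟨fun x y h => ?_⟩
  induction x using Quotient.inductionOn with | _ G
  induction y using Quotient.inductionOn with | _ H
  refine Quotient.sound (MarkedGraph.isomorphic_of_forall_isPattern fun r => ?_)
  obtain ⟨c, f, hf⟩ := G.exists_isPattern r
  have hopen : IsOpen (cylinder r c) :=
    TopologicalSpace.isOpen_generateFrom_of_mem ⟨r, G, (image_locallyIsomorphic hf).symm⟩
  have : mk H ∈ cylinder r c := (h.mem_open_iff hopen).1 (mk_mem_cylinder.2 ⟨f, hf⟩)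
  obtain ⟨g, hg⟩ := mk_mem_cylinder.1 this
  exact ⟨c, f, g, hf, hg⟩

theorem measurable_of_cylinder [Countable X] {Ω : Type*} [MeasurableSpace Ω]
    {F : Ω → GraphSpace k X} (hF : ∀ r c, MeasurableSet (F ⁻¹' cylinder r c)) : Measurable F := by
  rw [BorelSpace.measurable_eq (α := GraphSpace k X), borel_eq_generateFrom_of_subbasis rfl]
  refine measurable_generateFrom ?_
  rintro U ⟨r, G, rfl⟩
  obtain ⟨c, f, hf⟩ := G.exists_isPattern r
  rw [image_locallyIsomorphic hf]
  exact hF r c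

end GraphSpace

end LocalGraph

/-! ## Codes of marked graphs on the natural numbers -/

namespace LocalGraph

open GraphSpace

/-- A code of a marked graph: the vertex set, a set of pairs of vertices, the roots and the
marks. -/
abbrev Code (k : ℕ) (X : Type) : Type :=
  (ℕ → Bool) × (Sym2 ℕ → Bool) × (Fin k → ℕ) × (ℕ → X) × (Sym2 ℕ → X)

namespace Code

variable {k : ℕ} {X : Type}

/-- Adjacency in the graph with a given code. -/
def Adj (c : Code k X) (u v : ℕ) : Prop :=
  c.1 u = true ∧ c.1 v = true ∧ u ≠ v ∧ c.2.1 s(u, v) = true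

/-- There is a path of at most `n` edges. -/
def Within (c : Code k X) : ℕ → ℕ → ℕ → Prop
  | 0, u, v => u = v
  | n + 1, u, v => c.Within n u v ∨ ∃ w, c.Within n u w ∧ c.Adj w v

/-- The code describes a connected locally finite graph. -/
structure Valid (c : Code k X) : Prop where
  nonempty : ∃ v, c.1 v = true
  root : ∀ i v, c.2.2.1 i = v → c.1 v = true
  connected : ∀ u v, c.1 u = true → c.1 v = true → ∃ n, c.Within n u v
  locallyFinite : ∀ u, ∃ N : ℕ, ∀ v, c.Adj u v → v < N

/-- The graph described by a code. -/
def graph (c : Code k X) : SimpleGraph {v : ℕ // c.1 v = true} where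
  Adj u v := c.Adj u v
  symm := ⟨fun u v h => ⟨h.2.1, h.1, h.2.2.1.symm, by rw [Sym2.eq_swap]; exact h.2.2.2⟩⟩
  loopless := ⟨fun u h => h.2.2.1 rfl⟩

theorem Within.vert {c : Code k X} {n u v : ℕ} (h : c.Within n u v) (hu : c.1 u = true) :
    c.1 v = true := by
  induction n generalizing v with
  | zero => exact h ▸ hu
  | succ n ih =>
    rcases h with h | ⟨w, -, hwv⟩
    · exact ih h
    · exact hwv.2.1

theorem Within.reachable {c : Code k X} {n : ℕ} {u v : {v : ℕ // c.1 v = true}}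
    (h : c.Within n u v) : c.graph.Reachable u v := by
  induction n generalizing v with
  | zero => rw [Subtype.ext (h : (u : ℕ) = v)]
  | succ n ih =>
    rcases h with h | ⟨w, hw, hwv⟩
    · exact ih h
    · exact (ih (v := ⟨w, hwv.1⟩) hw).trans (SimpleGraph.Adj.reachable hwv)

theorem Valid.graph_connected {c : Code k X} (hc : c.Valid) : c.graph.Connected := by
  have : Nonempty {v : ℕ // c.1 v = true} := by
    obtain ⟨v, hv⟩ := hc.nonempty
    exact ⟨⟨v, hv⟩⟩
  exact ⟨fun u v => by
    obtain ⟨n, hn⟩ := hc.connected u v u.2 v.2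
    exact hn.reachable⟩

/-- The marked graph described by a valid code. -/
def toMarkedGraph (c : Code k X) (hc : c.Valid) : MarkedGraph k X where
  V := {v : ℕ // c.1 v = true}
  graph := c.graph
  connected := hc.graph_connected
  locallyFinite v := by
    obtain ⟨N, hN⟩ := hc.locallyFinite v
    exact ((Set.finite_lt_nat N).preimage Subtype.val_injective.injOn).subset fun w hw => hN w hw
  root i := ⟨c.2.2.1 i, hc.root i _ rfl⟩
  vmark v := c.2.2.2.1 v
  emark e := c.2.2.2.2 (e.map Subtype.val)

theorem Valid.dist_le_iff {c : Code k X} (hc : c.Valid) {u v : {v : ℕ // c.1 v = true}} {n : ℕ} :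
    c.graph.dist u v ≤ n ↔ c.Within n u v := by
  induction n generalizing v with
  | zero => rw [Nat.le_zero, hc.graph_connected.dist_eq_zero_iff, Subtype.ext_iff]; rfl
  | succ n ih =>
    rw [dist_le_succ_iff hc.graph_connected, ih]
    refine or_congr Iff.rfl ⟨?_, ?_⟩
    · rintro ⟨w, hw, hwv⟩
      exact ⟨w, ih.1 hw, hwv⟩
    · rintro ⟨w, hw, hwv⟩
      exact ⟨⟨w, hwv.1⟩, ih.2 hw, hwv⟩

theorem exists_code (G : MarkedGraph k X) :
    ∃ (c : Code k X) (hc : c.Valid), G.Isomorphic (c.toMarkedGraph hc) := by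
  classical
  obtain ⟨e, he⟩ := exists_injective_nat G.V
  have : Nonempty G.V := G.connected.nonempty
  -- Off the range of `e` this takes junk values, which only affect marks that are never read.
  let e' := Function.invFun e
  have he' : ∀ v, e' (e v) = v := Function.leftInverse_invFun he
  let c : Code k X := (fun n => decide (∃ v, e v = n),
    fun s => decide (∃ u v, G.graph.Adj u v ∧ s = s(e u, e v)), fun i => e (G.root i),
    fun n => G.vmark (e' n), fun s => G.emark (s.map e'))
  have hvert : ∀ v, c.1 (e v) = true := fun v => decide_eq_true ⟨v, rfl⟩
  have hvert' : ∀ n, c.1 n = true → ∃ v, e v = n := fun n => of_decide_eq_true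
  have hadj : ∀ u v, c.Adj (e u) (e v) ↔ G.graph.Adj u v := by
    intro u v
    constructor
    · rintro ⟨-, -, -, h⟩
      obtain ⟨u', v', huv, h⟩ := of_decide_eq_true h
      rcases Sym2.eq_iff.1 h with ⟨h1, h2⟩ | ⟨h1, h2⟩
      · rwa [he h1, he h2]
      · rw [he h1, he h2]
        exact huv.symm
    · exact fun h => ⟨hvert u, hvert v, fun h' => h.ne (he h'), decide_eq_true ⟨u, v, h, rfl⟩⟩
  have hwithin : ∀ n u v, G.graph.dist u v ≤ n → c.Within n (e u) (e v) := by
    intro n u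
    induction n with
    | zero => exact fun v hv => congrArg e (G.connected.dist_eq_zero_iff.1 (Nat.le_zero.1 hv))
    | succ n ih =>
      intro v hv
      rcases (dist_le_succ_iff G.connected).1 hv with h | ⟨w, hw, hwv⟩
      · exact Or.inl (ih v h)
      · exact Or.inr ⟨e w, ih w hw, (hadj _ _).2 hwv⟩
  have hc : c.Valid := by
    refine ⟨?_, ?_, ?_, ?_⟩
    · obtain ⟨v⟩ := this
      exact ⟨e v, hvert v⟩
    · rintro i v rfl
      exact hvert _
    · intro u v hu hv
      obtain ⟨u, rfl⟩ := hvert' u hu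
      obtain ⟨v, rfl⟩ := hvert' v hv
      exact ⟨_, hwithin _ u v le_rfl⟩
    · intro u
      by_cases hu : c.1 u = true
      · obtain ⟨u, rfl⟩ := hvert' u hu
        obtain ⟨N, hN⟩ := ((G.locallyFinite u).image e).bddAbove
        refine ⟨N + 1, fun v hv => Nat.lt_succ_of_le (hN ?_)⟩
        obtain ⟨v, rfl⟩ := hvert' v hv.2.1
        exact ⟨v, (hadj _ _).1 hv, rfl⟩
      · exact ⟨0, fun v hv => absurd hv.1 hu⟩
  let φ : G.V ≃ {n : ℕ // c.1 n = true} := Equiv.ofBijective (fun v => ⟨e v, hvert v⟩)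
    ⟨fun u v h => he (congrArg Subtype.val h), fun n => by
      obtain ⟨v, hv⟩ := hvert' n n.2
      exact ⟨v, Subtype.ext hv⟩⟩
  refine ⟨c, hc, ⟨φ, fun {u v} => hadj u v⟩, fun i => rfl, fun v => ?_, fun u v huv => ?_⟩
  · exact congrArg G.vmark (he' v)
  · change G.emark s(e' (e u), e' (e v)) = _
    rw [he', he']

/-- The isomorphism class of the one-vertex graph. -/
def trivialClass (k : ℕ) (X : Type) [Inhabited X] : GraphSpace k X :=
  mk { V := Unit
       graph := ⊥
       connected := ⟨fun _ _ => .rfl⟩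
       locallyFinite := fun _ => Set.toFinite _
       root := fun _ => ()
       vmark := fun _ => default
       emark := fun _ => default }

open Classical in
/-- The isomorphism class of the graph with a given code, with a default value for the codes that
are not valid. -/
noncomputable def decode [Inhabited X] (c : Code k X) : GraphSpace k X :=
  if hc : c.Valid then mk (c.toMarkedGraph hc) else trivialClass k X

theorem decode_of_valid [Inhabited X] {c : Code k X} (hc : c.Valid) :
    c.decode = mk (c.toMarkedGraph hc) :=
  dif_pos hc

theorem decode_surjective [Inhabited X] : Function.Surjective (decode : Code k X → _) := by
  intro x
  induction x using Quotient.inductionOn with | _ G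
  obtain ⟨c, hc, h⟩ := exists_code G
  exact ⟨c, (decode_of_valid hc).trans (Quotient.sound h).symm⟩

/-- The property of a code that corresponds to `MarkedGraph.IsPattern`. -/
def HasPattern (c : Code k X) (r : ℕ) (p : MarkedGraph.Pattern k X) (f : Fin p.1 → ℕ) : Prop :=
  Function.Injective f ∧
  (∀ v, (∃ i u, c.2.2.1 i = u ∧ c.Within r u v) ↔ ∃ i, f i = v) ∧
  (∀ i j, c.Adj (f i) (f j) ↔ p.2.1 i j = true) ∧
  (∀ i, f (p.2.2.1 i) = c.2.2.1 i) ∧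
  (∀ i, c.2.2.2.1 (f i) = p.2.2.2.1 i) ∧
  ∀ i j, c.Adj (f i) (f j) → c.2.2.2.2 s(f i, f j) = p.2.2.2.2 i j

theorem exists_isPattern_iff {c : Code k X} (hc : c.Valid) {r : ℕ} {p : MarkedGraph.Pattern k X} :
    (∃ f, (c.toMarkedGraph hc).IsPattern r p f) ↔ ∃ f, c.HasPattern r p f := by
  have hball : ∀ v : {v : ℕ // c.1 v = true}, v ∈ (c.toMarkedGraph hc).ball r ↔
      ∃ i u, c.2.2.1 i = u ∧ c.Within r u v := fun v => by
    simp only [exists_eq_left']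
    exact exists_congr fun i => hc.dist_le_iff
  constructor
  · rintro ⟨f, h1, h2, h3, h4, h5, h6⟩
    refine ⟨fun i => (f i).1, fun i j h => h1 (Subtype.ext h), fun v => ⟨?_, ?_⟩, h3,
      fun i => congrArg Subtype.val (h4 i), h5, h6⟩
    · rintro ⟨i, u, hu, huv⟩
      obtain ⟨j, hj⟩ := (h2 ⟨v, huv.vert (hc.root i u hu)⟩).1 ((hball _).2 ⟨i, u, hu, huv⟩)
      exact ⟨j, congrArg Subtype.val hj⟩
    · rintro ⟨i, rfl⟩
      exact (hball _).1 ((h2 _).2 ⟨i, rfl⟩)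
  · rintro ⟨f, h1, h2, h3, h4, h5, h6⟩
    have hf : ∀ i, c.1 (f i) = true := fun i => by
      obtain ⟨j, u, hu, huv⟩ := (h2 (f i)).2 ⟨i, rfl⟩
      exact huv.vert (hc.root j u hu)
    refine ⟨fun i => ⟨f i, hf i⟩, fun i j h => h1 (congrArg Subtype.val h), fun v => ?_, h3,
      fun i => Subtype.ext (h4 i), h5, h6⟩
    exact ((hball v).trans (h2 v.1)).trans (exists_congr fun i =>
      ⟨fun h => Subtype.ext h, congrArg Subtype.val⟩)

/-! ### Measurability through codes -/

section Measurability

variable [MeasurableSpace X]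

theorem measurable_adj (u v : ℕ) : Measurable fun c : Code k X => c.Adj u v := by
  unfold Adj
  fun_prop

theorem measurable_within (n u v : ℕ) : Measurable fun c : Code k X => c.Within n u v := by
  induction n generalizing v with
  | zero => exact measurable_const
  | succ n ih => exact (ih v).or (.exists fun w => (ih w).and (measurable_adj w v))

theorem measurable_valid : Measurable fun c : Code k X => c.Valid := by
  -- Every clause is a countable combination of coordinate events: roots are compared with all
  -- possible values `v`, and finiteness of a neighbourhood is boundedness by some `N`.
  have : (fun c : Code k X => c.Valid) = fun c => (∃ v, c.1 v = true) ∧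
      (∀ i v, c.2.2.1 i = v → c.1 v = true) ∧
      (∀ u v, c.1 u = true → c.1 v = true → ∃ n, c.Within n u v) ∧
      ∀ u, ∃ N : ℕ, ∀ v, c.Adj u v → v < N := by
    ext c
    exact ⟨fun h => ⟨h.1, h.2, h.3, h.4⟩, fun ⟨h1, h2, h3, h4⟩ => ⟨h1, h2, h3, h4⟩⟩
  rw [this]
  have h1 := measurable_adj (k := k) (X := X)
  have h2 := measurable_within (k := k) (X := X)
  fun_prop

variable [DiscreteMeasurableSpace X]

theorem measurable_hasPattern (r : ℕ) (p : MarkedGraph.Pattern k X) (f : Fin p.1 → ℕ) :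
    Measurable fun c : Code k X => c.HasPattern r p f := by
  have h1 := measurable_adj (k := k) (X := X)
  have h2 := measurable_within (k := k) (X := X)
  unfold HasPattern
  fun_prop

variable [Countable X] [Inhabited X]

theorem measurable_decode : Measurable (decode : Code k X → GraphSpace k X) := by
  refine measurable_of_cylinder fun r p => ?_
  have : (decode : Code k X → GraphSpace k X) ⁻¹' cylinder r p =
      {c | (c.Valid ∧ ∃ f, c.HasPattern r p f) ∨ (¬ c.Valid ∧ trivialClass k X ∈ cylinder r p)} := by
    ext c
    by_cases hc : c.Valid
    · simp [decode, hc, mk_mem_cylinder, exists_isPattern_iff]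
    · simp [decode, hc]
  rw [this, measurableSet_setOfPred]
  have h1 := measurable_valid (k := k) (X := X)
  exact (h1.and (.exists fun f => measurable_hasPattern r p f)).or (h1.not.and measurable_const)

/-- Measurability on the space of graphs can be verified on codes. -/
theorem measurable_of_code [NeZero k] {β : Type*} [MeasurableSpace β] {g : GraphSpace k X → β}
    (F : Code k X → β) (hF : Measurable F)
    (h : ∀ (c : Code k X) (hc : c.Valid), g (mk (c.toMarkedGraph hc)) = F c) : Measurable g := by
  classical
  -- Codes form a standard Borel space and `GraphSpace` is second countable and `T0`, so
  -- measurability can be tested after composition with a measurable surjection.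
  rw [← measurable_decode.measurable_comp_iff_of_surjective decode_surjective]
  have : g ∘ decode = fun c : Code k X => if c.Valid then F c else g (trivialClass k X) := by
    ext c
    by_cases hc : c.Valid
    · simp [hc, decode, h]
    · simp [hc, decode]
  rw [this]
  exact Measurable.ite measurable_valid.setOf hF measurable_const

end Measurability

/-- The same code with other roots. -/
def withRoots {l : ℕ} (c : Code k X) (root : Fin l → ℕ) : Code l X :=
  (c.1, c.2.1, root, c.2.2.2)

theorem within_congr {l : ℕ} {Y : Type} {c : Code k X} {c' : Code l Y} (h : c'.1 = c.1)
    (h' : c'.2.1 = c.2.1) (n u v : ℕ) : c'.Within n u v ↔ c.Within n u v := by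
  induction n generalizing v with
  | zero => exact Iff.rfl
  | succ n ih =>
    exact or_congr (ih v) (exists_congr fun w => and_congr (ih w) (by rw [Adj, Adj, h, h']))

theorem Valid.congr {l : ℕ} {Y : Type} {c : Code k X} {c' : Code l Y} (hc : c.Valid)
    (h : c'.1 = c.1) (h' : c'.2.1 = c.2.1) (hroot : ∀ i, c'.1 (c'.2.2.1 i) = true) :
    c'.Valid where
  nonempty := by rw [h]; exact hc.nonempty
  root := by rintro i v rfl; exact hroot i
  connected u v hu hv := by
    rw [h] at hu hv
    obtain ⟨n, hn⟩ := hc.connected u v hu hv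
    exact ⟨n, (within_congr h h' n u v).2 hn⟩
  locallyFinite := by
    simp only [Adj, h, h']
    exact hc.locallyFinite

theorem Valid.withRoots {l : ℕ} {c : Code k X} (hc : c.Valid)
    (root : Fin l → {v : ℕ // c.1 v = true}) : (c.withRoots fun i => root i).Valid :=
  hc.congr rfl rfl fun i => (root i).2

theorem decode_withRoots {l : ℕ} [Inhabited X] {c : Code k X} (hc : c.Valid)
    (root : Fin l → {v : ℕ // c.1 v = true}) :
    (c.withRoots fun i => root i).decode = mk ((c.toMarkedGraph hc).withRoots root) :=
  decode_of_valid (hc.withRoots root)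

theorem measurable_withRoots [MeasurableSpace X] {l : ℕ} {r : Code k X → Fin l → ℕ}
    (hr : Measurable r) : Measurable fun c : Code k X => c.withRoots (r c) := by
  unfold withRoots
  fun_prop

end Code

namespace GraphSpace

variable {X : Type} [MeasurableSpace X] [DiscreteMeasurableSpace X] [Countable X] [Inhabited X]

/-- On codes the sum over vertices becomes a sum over `ℕ` of measurable functions of the re-rooted
code, with terms off the vertex set put to zero. -/
theorem measurable_massOut {f : GraphSpace 2 X → ℝ≥0∞} (hf : Measurable f) :
    Measurable (massOut f) := by
  classical
  refine Code.measurable_of_code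
    (fun c => ∑' v : ℕ, if c.1 v = true then f (c.withRoots ![c.2.2.1 0, v]).decode else 0)
    (Measurable.tsum fun v => Measurable.ite ?_ (hf.comp (Code.measurable_decode.comp
      (Code.measurable_withRoots (measurable_pi_iff.2 fun i => ?_)))) measurable_const)
    fun c hc => ?_
  · exact Measurable.setOf (by fun_prop)
  · fin_cases i
    · change Measurable fun c : Code 1 X => c.2.2.1 0
      fun_prop
    · exact measurable_const
  · refine Eq.trans (tsum_congr fun o => ?_) ((tsum_subtype {v : ℕ | c.1 v = true}
      fun v => f (c.withRoots ![c.2.2.1 0, v]).decode).trans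
      (tsum_congr fun v => Set.indicator_apply _ _ _))
    refine congrArg f (((Code.decode_withRoots hc _).symm).trans (congrArg Code.decode ?_))
    refine congrArg c.withRoots (funext fun i => ?_)
    fin_cases i <;> rfl

theorem measurable_massIn {f : GraphSpace 2 X → ℝ≥0∞} (hf : Measurable f) :
    Measurable (massIn f) := by
  classical
  refine Code.measurable_of_code
    (fun c => ∑' v : ℕ, if c.1 v = true then f (c.withRoots ![v, c.2.2.1 0]).decode else 0)
    (Measurable.tsum fun v => Measurable.ite ?_ (hf.comp (Code.measurable_decode.comp
      (Code.measurable_withRoots (measurable_pi_iff.2 fun i => ?_)))) measurable_const)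
    fun c hc => ?_
  · exact Measurable.setOf (by fun_prop)
  · fin_cases i
    · exact measurable_const
    · change Measurable fun c : Code 1 X => c.2.2.1 0
      fun_prop
  · refine Eq.trans (tsum_congr fun o => ?_) ((tsum_subtype {v : ℕ | c.1 v = true}
      fun v => f (c.withRoots ![v, c.2.2.1 0]).decode).trans
      (tsum_congr fun v => Set.indicator_apply _ _ _))
    refine congrArg f (((Code.decode_withRoots hc _).symm).trans (congrArg Code.decode ?_))
    refine congrArg c.withRoots (funext fun i => ?_)
    fin_cases i <;> rfl

end GraphSpace

end LocalGraph

/-! ## Random functionals of marked graphs -/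

namespace LocalGraph

open GraphSpace Thinning

section Law

variable {k : ℕ} {X : Type}

/-- The functional `F` of a marked graph and coins is invariant under isomorphisms. -/
def IsoInvariant {β : Type*} (F : ∀ G : MarkedGraph k X, (ℕ → G.V → Bool) → β) : Prop :=
  ∀ (G H : MarkedGraph k X) (φ : G.graph ≃g H.graph), (∀ i, φ (G.root i) = H.root i) →
    (∀ v, H.vmark (φ v) = G.vmark v) →
    (∀ u v, G.graph.Adj u v → H.emark s(φ u, φ v) = G.emark s(u, v)) →
    ∀ b, F G (fun n v => b n (φ v)) = F H b

variable [NeZero k] [MeasurableSpace X] [DiscreteMeasurableSpace X] [Countable X] [Inhabited X]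
  {β : Type*} [MeasurableSpace β]

/-- The law of an invariant random functional is a measurable function of the isomorphism class,
if the functional is measurable on codes. -/
theorem exists_law {F : ∀ G : MarkedGraph k X, (ℕ → G.V → Bool) → β} (hinv : IsoInvariant F)
    {F' : Code k X × (ℕ → ℕ → Bool) → β} (hF' : Measurable F')
    (h : ∀ (c : Code k X) (hc : c.Valid) b,
      F (c.toMarkedGraph hc) (fun n v => b n v.1) = F' (c, b)) :
    ∃ κ : GraphSpace k X → Measure β, Measurable κ ∧ (∀ G, Measurable (F G)) ∧
      ∀ G, κ (mk G) = (coins G.V).map (F G) := by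
  classical
  have hmeas : ∀ G, Measurable (F G) := by
    intro G
    obtain ⟨c, hc, φ, h1, h2, h3⟩ := Code.exists_code G
    -- The coins are moved to the code; the value `false` off its vertex set is irrelevant.
    let ext : (ℕ → G.V → Bool) → ℕ → ℕ → Bool := fun b n m =>
      if hm : c.1 m = true then b n (φ.symm ⟨m, hm⟩) else false
    have hext : Measurable ext := by
      refine measurable_pi_iff.2 fun n => measurable_pi_iff.2 fun m => ?_
      by_cases hm : c.1 m = true
      · simp only [ext, hm, dite_true]
        fun_prop
      · simp only [ext, hm]
        exact measurable_const
    have : F G = fun b => F' (c, ext b) := by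
      funext b
      rw [← h c hc (ext b), ← hinv _ _ φ h1 h2 h3]
      congr 1
      funext n v
      have hv : c.1 (φ v).1 = true := (φ v).2
      simp only [ext, hv, dite_true]
      exact congrArg (b n) (φ.symm_apply_apply v).symm
    rw [this]
    exact hF'.comp (measurable_const.prodMk hext)
  have hlaw : ∀ G H : MarkedGraph k X, G.Isomorphic H →
      (coins G.V).map (F G) = (coins H.V).map (F H) := by
    rintro G H ⟨φ, h1, h2, h3⟩
    rw [← coins_map φ.toEquiv.toEmbedding, Measure.map_map (hmeas G) (by fun_prop)]
    congr 1
    funext b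
    exact hinv G H φ h1 h2 h3 b
  let κ : GraphSpace k X → Measure β := Quotient.lift (fun G => (coins G.V).map (F G)) hlaw
  refine ⟨κ, ?_, hmeas, fun G => rfl⟩
  refine Code.measurable_of_code (fun c => (coins ℕ).map fun b => F' (c, b)) ?_ fun c hc => ?_
  · refine Measure.measurable_of_measurable_coe _ fun s hs => ?_
    have : ∀ c, (coins ℕ).map (fun b => F' (c, b)) s = coins ℕ (Prod.mk c ⁻¹' (F' ⁻¹' s)) :=
      fun c => Measure.map_apply (hF'.comp measurable_prodMk_left) hs
    simp only [this]
    exact measurable_measure_prodMk_left (hF' hs)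
  · change (coins (c.toMarkedGraph hc).V).map (F (c.toMarkedGraph hc)) = _
    have hres : Measurable fun (b : ℕ → ℕ → Bool) n (v : (c.toMarkedGraph hc).V) => b n v.1 := by
      fun_prop
    -- One family of coins on `ℕ` serves all codes, by restriction to their vertices.
    have hmap : coins (c.toMarkedGraph hc).V = (coins ℕ).map fun b n v => b n v.1 :=
      (coins_map (Function.Embedding.subtype _)).symm
    rw [hmap, Measure.map_map (hmeas _) hres]
    congr 1
    funext b
    exact h c hc b

end Law

/-! ## The thinned graph -/

namespace MarkedGraph

variable {k : ℕ} {X : Type}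

open Classical in
/-- Add the marks of a site percolation. -/
noncomputable def addSites (G : MarkedGraph k X) (ω : Set G.V) : MarkedGraph k (X × Bool) :=
  { G with
    vmark := fun v => (G.vmark v, decide (v ∈ ω))
    emark := fun e => (G.emark e, decide (∀ v ∈ e, v ∈ ω)) }

theorem isomorphic_addSites {G H : MarkedGraph k X} (φ : G.graph ≃g H.graph)
    (h1 : ∀ i, φ (G.root i) = H.root i) (h2 : ∀ v, H.vmark (φ v) = G.vmark v)
    (h3 : ∀ u v, G.graph.Adj u v → H.emark s(φ u, φ v) = G.emark s(u, v))
    {ω : Set G.V} {ω' : Set H.V} (hω : ∀ v, φ v ∈ ω' ↔ v ∈ ω) :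
    (G.addSites ω).Isomorphic (H.addSites ω') := by
  refine ⟨φ, h1, fun v => Prod.ext (h2 v) ?_, fun u v huv => Prod.ext (h3 u v huv) ?_⟩
  · exact decide_eq_decide.2 (hω v)
  · exact decide_eq_decide.2 (Sym2.ball.trans ((and_congr (hω u) (hω v)).trans Sym2.ball.symm))

/-- Close the vertices that are removed from the graph of open vertices and edges. -/
noncomputable def thinned (G : MarkedGraph k X) (p : X → Bool) (α : ℝ) (b : ℕ → G.V → Bool) :
    MarkedGraph k (X × Bool) :=
  G.addSites (removed (G.openSubgraph p).Adj α b)ᶜ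

theorem openSubgraph_adj_iso {G H : MarkedGraph k X} (p : X → Bool) (φ : G.graph ≃g H.graph)
    (h2 : ∀ v, H.vmark (φ v) = G.vmark v)
    (h3 : ∀ u v, G.graph.Adj u v → H.emark s(φ u, φ v) = G.emark s(u, v)) (u v : G.V) :
    (G.openSubgraph p).Adj u v ↔ (H.openSubgraph p).Adj (φ u) (φ v) := by
  simp only [openSubgraph, h2]
  constructor
  · rintro ⟨h, h'⟩
    exact ⟨φ.map_rel_iff.2 h, by rwa [h3 u v h]⟩
  · rintro ⟨h, h'⟩
    have h := φ.map_rel_iff.1 h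
    exact ⟨h, by rwa [h3 u v h] at h'⟩

end MarkedGraph

namespace Code

variable {k : ℕ} {X : Type}

/-- Adjacency in the graph of open vertices and edges. -/
def OpenAdj (c : Code k X) (p : X → Bool) (u v : ℕ) : Prop :=
  c.Adj u v ∧ p (c.2.2.2.2 s(u, v)) = true ∧ p (c.2.2.2.1 u) = true ∧ p (c.2.2.2.1 v) = true

open Classical in
/-- Add the marks of a site percolation. -/
noncomputable def addSites (c : Code k X) (ω : Set ℕ) : Code k (X × Bool) :=
  (c.1, c.2.1, c.2.2.1, fun v => (c.2.2.2.1 v, decide (v ∈ ω)),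
    fun e => (c.2.2.2.2 e, decide (∀ v ∈ e, v ∈ ω)))

/-- The code of the thinned graph. -/
noncomputable def thinned (c : Code k X) (p : X → Bool) (α : ℝ) (b : ℕ → ℕ → Bool) :
    Code k (X × Bool) :=
  c.addSites (removed (c.OpenAdj p) α b)ᶜ

theorem range_of_openAdj {c : Code k X} {p : X → Bool} (u : {v : ℕ // c.1 v = true}) (w : ℕ)
    (h : c.OpenAdj p u w) : w ∈ Set.range (Function.Embedding.subtype fun v => c.1 v = true) :=
  ⟨⟨w, h.1.2.1⟩, rfl⟩

theorem removed_toMarkedGraph {c : Code k X} (hc : c.Valid) (p : X → Bool) (α : ℝ)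
    (b : ℕ → ℕ → Bool) :
    removed ((c.toMarkedGraph hc).openSubgraph p).Adj α (fun n v => b n v.1) =
      (Subtype.val : {v : ℕ // c.1 v = true} → ℕ) ⁻¹' removed (c.OpenAdj p) α b :=
  removed_comp (Function.Embedding.subtype fun v => c.1 v = true) (fun _ _ => Iff.rfl)
    range_of_openAdj b

theorem charge_toMarkedGraph {c : Code k X} (hc : c.Valid) (p : X → Bool) (α : ℝ)
    (b : ℕ → ℕ → Bool) (u v : {v : ℕ // c.1 v = true}) :
    charge ((c.toMarkedGraph hc).openSubgraph p).Adj α (fun n v => b n v.1) u v =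
      charge (c.OpenAdj p) α b u v :=
  charge_comp (Function.Embedding.subtype fun v => c.1 v = true) (fun _ _ => Iff.rfl)
    range_of_openAdj b u v

theorem decode_thinned [Inhabited X] {c : Code k X} (hc : c.Valid) (p : X → Bool) (α : ℝ)
    (b : ℕ → ℕ → Bool) :
    mk ((c.toMarkedGraph hc).thinned p α fun n v => b n v.1) = (c.thinned p α b).decode := by
  have hc' : (c.thinned p α b).Valid := hc.congr rfl rfl fun i => hc.root i _ rfl
  rw [decode_of_valid hc']
  have hrem : (c.toMarkedGraph hc).thinned p α (fun n v => b n v.1) = (c.toMarkedGraph hc).addSites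
      ((Subtype.val : {v : ℕ // c.1 v = true} → ℕ) ⁻¹' removed (c.OpenAdj p) α b)ᶜ := by
    rw [MarkedGraph.thinned, removed_toMarkedGraph]
    rfl
  rw [hrem]
  refine Quotient.sound ⟨SimpleGraph.Iso.refl, fun _ => rfl, fun v => ?_, fun u v _ => ?_⟩
  · exact Prod.ext rfl (decide_eq_decide.2 Iff.rfl)
  · exact Prod.ext rfl (decide_eq_decide.2 (Iff.trans Sym2.ball (Iff.symm
      (Sym2.ball (p := fun v : {v : ℕ // c.1 v = true} => v.1 ∈ (removed (c.OpenAdj p) α b)ᶜ)))))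

section Measurability

variable [MeasurableSpace X] [DiscreteMeasurableSpace X]

theorem measurable_openAdj (p : X → Bool) (u v : ℕ) :
    Measurable fun c : Code k X => c.OpenAdj p u v := by
  have h1 := measurable_adj (k := k) (X := X)
  have hp : Measurable p := .of_discrete
  unfold OpenAdj
  fun_prop

theorem measurable_openAdj_fst {Ω : Type*} [MeasurableSpace Ω] (p : X → Bool) (u v : ℕ) :
    Measurable fun q : Code k X × Ω => q.1.OpenAdj p u v :=
  (measurable_openAdj p u v).comp measurable_fst

theorem measurable_thinned (p : X → Bool) (α : ℝ) :
    Measurable fun q : Code k X × (ℕ → ℕ → Bool) => q.1.thinned p α q.2 := by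
  classical
  have h : ∀ v, Measurable fun q : Code k X × (ℕ → ℕ → Bool) =>
      v ∈ (removed (q.1.OpenAdj p) α q.2)ᶜ := fun v =>
    (measurable_mem_removed (measurable_openAdj_fst p) (fun n v => by fun_prop) v).not
  have hd : Measurable fun P : Prop => decide P := .of_discrete
  unfold thinned addSites
  refine .prodMk (by fun_prop) (.prodMk (by fun_prop) (.prodMk (by fun_prop) (.prodMk
    (measurable_pi_iff.2 fun v => .prodMk (by fun_prop) (hd.comp (h v)))
    (measurable_pi_iff.2 fun e => .prodMk (by fun_prop)
      (hd.comp (.forall fun v => measurable_const.imp (h v)))))))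

end Measurability

end Code

/-! ### Laws of the thinned graph and of the charge -/

section Kernels

variable {k : ℕ} {X : Type} [MeasurableSpace X] [DiscreteMeasurableSpace X] [Countable X]
  [Inhabited X]

/-- The case `k = 1` yields the percolation; `k = 2` is needed to average transports over the coins.
-/
theorem exists_thinned_law [NeZero k] (p : X → Bool) (α : ℝ) :
    ∃ κ : GraphSpace k X → Measure (GraphSpace k (X × Bool)), Measurable κ ∧
      (∀ G : MarkedGraph k X, Measurable fun b => mk (G.thinned p α b)) ∧
      ∀ G, κ (mk G) = (coins G.V).map fun b => mk (G.thinned p α b) := by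
  refine exists_law (F := fun G b => mk (G.thinned p α b)) ?_
    (F' := fun q => (q.1.thinned p α q.2).decode)
    (Code.measurable_decode.comp (Code.measurable_thinned p α))
    fun c hc b => Code.decode_thinned hc p α b
  intro G H φ h1 h2 h3 b
  have hrem := removed_comp (α := α) φ.toEquiv.toEmbedding
    (MarkedGraph.openSubgraph_adj_iso p φ h2 h3) (fun u w _ => φ.surjective w) b
  exact Quotient.sound (MarkedGraph.isomorphic_addSites φ h1 h2 h3
    fun v => not_congr (Set.ext_iff.1 hrem v).symm)

theorem exists_charge_law (p : X → Bool) (α : ℝ) :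
    ∃ κ : GraphSpace 2 X → Measure ℝ≥0∞, Measurable κ ∧
      (∀ G : MarkedGraph 2 X, Measurable fun b =>
        charge (G.openSubgraph p).Adj α b (G.root 0) (G.root 1)) ∧
      ∀ G, κ (mk G) = (coins G.V).map fun b =>
        charge (G.openSubgraph p).Adj α b (G.root 0) (G.root 1) := by
  refine exists_law (F := fun G b => charge (G.openSubgraph p).Adj α b (G.root 0) (G.root 1)) ?_
    -- Summing over all possible pairs of roots replaces evaluation at roots that vary with the
    -- code.
    (F' := fun q => ∑' m : ℕ × ℕ, if q.1.2.2.1 0 = m.1 ∧ q.1.2.2.1 1 = m.2 then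
      charge (q.1.OpenAdj p) α q.2 m.1 m.2 else 0) ?_ fun c hc b => ?_
  · intro G H φ h1 h2 h3 b
    simp only [← h1]
    exact charge_comp φ.toEquiv.toEmbedding
      (MarkedGraph.openSubgraph_adj_iso p φ h2 h3) (fun u w _ => φ.surjective w) b _ _
  · refine Measurable.tsum fun m => Measurable.ite (Measurable.setOf (by fun_prop))
      (measurable_charge (Code.measurable_openAdj_fst p) (fun n v => by fun_prop) _ _)
      measurable_const
  · rw [tsum_eq_single (c.2.2.1 0, c.2.2.1 1)]
    · simp only [and_self, if_true]
      exact Code.charge_toMarkedGraph hc p α b _ _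
    · rintro ⟨m, m'⟩ hm
      refine if_neg ?_
      rintro ⟨rfl, rfl⟩
      exact hm rfl

end Kernels

end LocalGraph

/-! ## Expansion of the thinned graph -/

namespace LocalGraph

open GraphSpace Thinning

section Expansion

variable {k : ℕ} {X : Type}

/-- `Satisfies` speaks of all representatives; invariance reduces it to one. -/
theorem satisfies_mk {P : MarkedGraph k X → Prop} (hP : ∀ G H, G.Isomorphic H → P G → P H)
    {G : MarkedGraph k X} : (mk G).Satisfies P ↔ P G :=
  ⟨fun h => h G rfl, fun h _ hH => hP _ _ (Quotient.exact hH.symm) h⟩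

theorem satisfies_mk_root_closed {G : MarkedGraph 1 (X × Bool)} :
    (mk G).Satisfies (fun G : MarkedGraph 1 (X × Bool) => (G.vmark (G.root 0)).2 = false) ↔
      (G.vmark (G.root 0)).2 = false := by
  refine satisfies_mk (P := fun G : MarkedGraph 1 (X × Bool) => (G.vmark (G.root 0)).2 = false) ?_
  rintro G H ⟨φ, h1, h2, -⟩ hG
  rw [← h1, h2, hG]

/-- The marks in `Bool` are the marks of a site percolation, and in the open subgraph the finite
sets with small boundary meet finite connected components. -/
def MarkedGraph.IsGood (p : X → Bool) (α : ℝ) (G : MarkedGraph k (X × Bool)) : Prop :=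
  (∀ u v, G.graph.Adj u v → ((G.emark s(u, v)).2 = true ↔
    (G.vmark u).2 = true ∧ (G.vmark v).2 = true)) ∧
  Expanding (G.openSubgraph fun m => p m.1).Adj α {v | (G.vmark v).2 = true}

theorem MarkedGraph.IsGood.iso {p : X → Bool} {α : ℝ} {G H : MarkedGraph k (X × Bool)}
    (h : G.Isomorphic H) (hG : G.IsGood p α) : H.IsGood p α := by
  obtain ⟨φ, -, h2, h3⟩ := h
  constructor
  · intro u v huv
    obtain ⟨u, rfl⟩ := φ.surjective u
    obtain ⟨v, rfl⟩ := φ.surjective v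
    have huv := φ.map_rel_iff.1 huv
    rw [h2, h2, h3 u v huv]
    exact hG.1 u v huv
  · refine (expanding_map φ.toEquiv.toEmbedding
      (MarkedGraph.openSubgraph_adj_iso (fun m => p m.1) φ h2 h3) (fun u w _ => φ.surjective w)
      (fun w _ => φ.surjective w)).2 ?_
    have hO : φ.toEquiv.toEmbedding ⁻¹' {v | (H.vmark v).2 = true} = {v | (G.vmark v).2 = true} := by
      ext v
      exact Eq.congr (congrArg Prod.snd (h2 v)) rfl
    exact hO ▸ hG.2

theorem MarkedGraph.isGood_thinned (G : MarkedGraph k X) (p : X → Bool) (α : ℝ)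
    {b : ℕ → G.V → Bool} (hb : Generic b) : (G.thinned p α b).IsGood p α := by
  constructor
  · intro u v _
    simp only [thinned, addSites, decide_eq_true_eq]
    exact Sym2.ball
  · have h := expanding_compl_removed (α := α) (b := b) (A := (G.openSubgraph p).Adj)
      (fun u v h => h.symm) (fun u => (G.locallyFinite u).subset fun w hw => hw.1) hb
    have hO : {v : G.V | ((G.thinned p α b).vmark v).2 = true} =
        (removed (G.openSubgraph p).Adj α b)ᶜ := by
      ext v
      exact @decide_eq_true_iff _ (Classical.propDecidable _)
    exact hO ▸ h

theorem MarkedGraph.IsGood.le_expansion {p : X → Bool} {α : ℝ} {G : MarkedGraph k (X × Bool)}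
    (h : G.IsGood p α)
    (C : (G.openSubgraph (fun m => p m.1) ⊓ G.openSubgraph (fun m => m.2)).coe.ConnectedComponent)
    (hC : C.supp.Infinite) : α ≤ C.toSimpleGraph.innerVertexExpansionConstant := by
  refine Expanding.le_innerVertexExpansionConstant h.2 (Function.Embedding.subtype _) (fun u => u.2.2)
    (fun u v => ?_) (fun u w hw huw => ⟨⟨w, huw.2.2.2, hw⟩, rfl⟩) C hC
  -- By the site property, intersecting with the second open subgraph deletes no edge between
  -- surviving vertices.
  refine ⟨fun huv => huv.1, fun huv => ⟨huv, huv.1, ?_, u.2.2, v.2.2⟩⟩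
  exact (h.1 u v huv.1).2 ⟨u.2.2, v.2.2⟩

theorem measurableSet_isGood [NeZero k] [MeasurableSpace X] [DiscreteMeasurableSpace X]
    [Countable X] [Inhabited X] (p : X → Bool) (α : ℝ) :
    MeasurableSet {x : GraphSpace k (X × Bool) | x.Satisfies (MarkedGraph.IsGood p α)} := by
  rw [measurableSet_setOfPred]
  refine Code.measurable_of_code (fun c => (∀ u v, c.Adj u v → ((c.2.2.2.2 s(u, v)).2 = true ↔
    (c.2.2.2.1 u).2 = true ∧ (c.2.2.2.1 v).2 = true)) ∧
    Expanding (c.OpenAdj fun m => p m.1) α {v | c.1 v = true ∧ (c.2.2.2.1 v).2 = true})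
    (.and ?_ (measurable_expanding (Code.measurable_openAdj _) fun v => ?_)) fun c hc => ?_
  · have h := Code.measurable_adj (k := k) (X := X × Bool)
    fun_prop
  · change Measurable fun c : Code k (X × Bool) => c.1 v = true ∧ (c.2.2.2.1 v).2 = true
    fun_prop
  · refine propext ((satisfies_mk fun _ _ => MarkedGraph.IsGood.iso).trans (and_congr ?_ ?_))
    · exact ⟨fun h u v huv => h ⟨u, huv.1⟩ ⟨v, huv.2.1⟩ huv, fun h u v huv => h u.1 v.1 huv⟩
    · rw [expanding_map (Function.Embedding.subtype fun v => c.1 v = true)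
        (A := ((c.toMarkedGraph hc).openSubgraph fun m => p m.1).Adj) (fun _ _ => Iff.rfl)
        Code.range_of_openAdj fun v hv => ⟨⟨v, hv.1⟩, rfl⟩]
      have hO : {v : {v : ℕ // c.1 v = true} | (c.2.2.2.1 v.1).2 = true} =
          (Function.Embedding.subtype fun v => c.1 v = true) ⁻¹'
            {v | c.1 v = true ∧ (c.2.2.2.1 v).2 = true} := by
        ext v
        exact ⟨fun h => ⟨v.2, h⟩, fun h => h.2⟩
      exact hO ▸ Iff.rfl

theorem measurableSet_root_closed [MeasurableSpace X] [DiscreteMeasurableSpace X]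
    [Countable X] [Inhabited X] : MeasurableSet {x : GraphSpace 1 (X × Bool) |
      x.Satisfies fun G => (G.vmark (G.root 0)).2 = false} := by
  rw [measurableSet_setOfPred]
  refine Code.measurable_of_code (fun c => ∃ v, c.2.2.1 0 = v ∧ (c.2.2.2.1 v).2 = false)
    (by fun_prop) fun c hc => ?_
  rw [satisfies_mk_root_closed]
  exact propext (by simp [Code.toMarkedGraph])

end Expansion

/-! ### The percolation `Ξ.bind κ` -/

section Bind

variable {k : ℕ} {X : Type} {p : X → Bool} {α : ℝ}

/-- The kernel `κ` maps a graph to the law of the thinned graph. -/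
structure IsThinnedLaw (p : X → Bool) (α : ℝ)
    (κ : GraphSpace k X → Measure (GraphSpace k (X × Bool))) : Prop where
  measurable : Measurable κ
  measurable_mk : ∀ G : MarkedGraph k X, Measurable fun b => mk (G.thinned p α b)
  map_eq : ∀ G, κ (mk G) = (coins G.V).map fun b => mk (G.thinned p α b)

theorem IsThinnedLaw.lintegral {κ : GraphSpace k X → Measure (GraphSpace k (X × Bool))}
    (h : IsThinnedLaw p α κ) {f : GraphSpace k (X × Bool) → ℝ≥0∞} (hf : Measurable f)
    (G : MarkedGraph k X) :
    ∫⁻ y, f y ∂κ (GraphSpace.mk G) = ∫⁻ b, f (GraphSpace.mk (G.thinned p α b)) ∂coins G.V := by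
  rw [h.map_eq, lintegral_map hf (h.measurable_mk G)]

theorem IsThinnedLaw.apply {κ : GraphSpace k X → Measure (GraphSpace k (X × Bool))}
    (h : IsThinnedLaw p α κ) {s : Set (GraphSpace k (X × Bool))} (hs : MeasurableSet s)
    (G : MarkedGraph k X) : κ (GraphSpace.mk G) s = coins G.V {b | GraphSpace.mk (G.thinned p α b) ∈ s} := by
  rw [h.map_eq, Measure.map_apply (h.measurable_mk G) hs]
  rfl

variable [MeasurableSpace X] [DiscreteMeasurableSpace X] [Countable X] [Inhabited X]

theorem measurable_mapMarks_fst [NeZero k] :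
    Measurable (mapMarks Prod.fst : GraphSpace k (X × Bool) → GraphSpace k X) := by
  refine Code.measurable_of_code (fun c => Code.decode
    ((c.1, c.2.1, c.2.2.1, fun v => (c.2.2.2.1 v).1, fun e => (c.2.2.2.2 e).1) : Code k X))
    (Code.measurable_decode.comp (by fun_prop)) fun c hc => ?_
  have hc' : Code.Valid ((c.1, c.2.1, c.2.2.1, fun v => (c.2.2.2.1 v).1, fun e => (c.2.2.2.2 e).1) :
    Code k X) := hc.congr rfl rfl fun i => hc.root i _ rfl
  exact (Code.decode_of_valid hc').symm

/-- Neither the coins nor the thinning depend on the roots. Hence averaging over the coins commutes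
with `massOut` and `massIn`, and unimodularity of `Ξ` applies to the averaged transport. -/
theorem IsThinnedLaw.isUnimodular {κ : GraphSpace 1 X → Measure (GraphSpace 1 (X × Bool))}
    (h : IsThinnedLaw p α κ) {Ξ : Measure (GraphSpace 1 X)} (hΞ : IsUnimodular Ξ) :
    IsUnimodular (Ξ.bind κ) := by
  intro f hf
  obtain ⟨κ₂, h1, h2, h3⟩ := exists_thinned_law (k := 2) p α
  have h₂ : IsThinnedLaw p α κ₂ := ⟨h1, h2, h3⟩
  have hF : Measurable fun z => ∫⁻ y, f y ∂κ₂ z := (Measure.measurable_lintegral hf).comp h1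
  have hout : ∀ x, ∫⁻ y, massOut f y ∂κ x = massOut (fun z => ∫⁻ y, f y ∂κ₂ z) x := by
    refine fun x => Quotient.inductionOn x fun G => ?_
    calc ∫⁻ y, massOut f y ∂κ (GraphSpace.mk G)
        = ∫⁻ b, ∑' o : G.V, f (GraphSpace.mk ((G.withRoots ![G.root 0, o]).thinned p α b))
            ∂coins G.V := h.lintegral (measurable_massOut hf) G
      _ = ∑' o : G.V, ∫⁻ b, f (GraphSpace.mk ((G.withRoots ![G.root 0, o]).thinned p α b))
            ∂coins G.V := lintegral_tsum fun o => (hf.comp (h2 (G.withRoots ![G.root 0, o]))).aemeasurable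
      _ = ∑' o : G.V, ∫⁻ y, f y ∂κ₂ (GraphSpace.mk (G.withRoots ![G.root 0, o])) :=
          tsum_congr fun o => (h₂.lintegral hf (G.withRoots ![G.root 0, o])).symm
  have hin : ∀ x, ∫⁻ y, massIn f y ∂κ x = massIn (fun z => ∫⁻ y, f y ∂κ₂ z) x := by
    refine fun x => Quotient.inductionOn x fun G => ?_
    calc ∫⁻ y, massIn f y ∂κ (GraphSpace.mk G)
        = ∫⁻ b, ∑' o : G.V, f (GraphSpace.mk ((G.withRoots ![o, G.root 0]).thinned p α b))
            ∂coins G.V := h.lintegral (measurable_massIn hf) G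
      _ = ∑' o : G.V, ∫⁻ b, f (GraphSpace.mk ((G.withRoots ![o, G.root 0]).thinned p α b))
            ∂coins G.V := lintegral_tsum fun o => (hf.comp (h2 (G.withRoots ![o, G.root 0]))).aemeasurable
      _ = ∑' o : G.V, ∫⁻ y, f y ∂κ₂ (GraphSpace.mk (G.withRoots ![o, G.root 0])) :=
          tsum_congr fun o => (h₂.lintegral hf (G.withRoots ![o, G.root 0])).symm
  rw [Measure.lintegral_bind h.measurable.aemeasurable (measurable_massOut hf).aemeasurable,
    Measure.lintegral_bind h.measurable.aemeasurable (measurable_massIn hf).aemeasurable,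
    lintegral_congr hout, lintegral_congr hin]
  exact hΞ _ hF

theorem IsThinnedLaw.isMarking {κ : GraphSpace 1 X → Measure (GraphSpace 1 (X × Bool))}
    (h : IsThinnedLaw p α κ) {Ξ : Measure (GraphSpace 1 X)} [IsProbabilityMeasure Ξ]
    (hΞ : IsUnimodular Ξ) : IsMarking Ξ (Ξ.bind κ) where
  isProbabilityMeasure := by
    refine ⟨?_⟩
    rw [Measure.bind_apply .univ h.measurable.aemeasurable]
    have : ∀ x, κ x Set.univ = 1 := by
      intro x
      induction x using Quotient.inductionOn with | _ G
      exact (h.apply .univ G).trans measure_univ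
    simp [this]
  isUnimodular := h.isUnimodular hΞ
  map_eq := by
    ext s hs
    have hs' := measurable_mapMarks_fst hs
    rw [Measure.map_apply measurable_mapMarks_fst hs,
      Measure.bind_apply hs' h.measurable.aemeasurable, ← lintegral_indicator_one hs]
    refine lintegral_congr fun x => ?_
    induction x using Quotient.inductionOn with | _ G
    refine (h.apply hs' G).trans ?_
    -- Forgetting the new marks recovers `G` for every outcome of the coins.
    change coins G.V {_b | GraphSpace.mk G ∈ s} = s.indicator 1 (GraphSpace.mk G)
    by_cases hG : GraphSpace.mk G ∈ s <;> simp [hG]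

theorem IsThinnedLaw.ae_isGood {κ : GraphSpace 1 X → Measure (GraphSpace 1 (X × Bool))}
    (h : IsThinnedLaw p α κ) (Ξ : Measure (GraphSpace 1 X)) :
    ∀ᵐ x ∂Ξ.bind κ, x.Satisfies (MarkedGraph.IsGood p α) := by
  have hs := (measurableSet_isGood (k := 1) p α).compl
  refine mem_ae_iff.2 ?_
  rw [Measure.bind_apply hs h.measurable.aemeasurable]
  refine (lintegral_congr fun x => ?_).trans lintegral_zero
  induction x using Quotient.inductionOn with | _ G
  refine (h.apply hs G).trans (measure_mono_null ?_ (mem_ae_iff.1 (ae_generic (V := G.V))))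
  exact fun b hb hgen => hb ((satisfies_mk fun _ _ => MarkedGraph.IsGood.iso).2
    (G.isGood_thinned p α hgen))

/-- Mass transport for the expected charge `F`: the probability that the root is closed is at most
the expected mass received, which equals the expected mass sent. -/
theorem IsThinnedLaw.rate_le {κ : GraphSpace 1 X → Measure (GraphSpace 1 (X × Bool))}
    (h : IsThinnedLaw p α κ) (hα : 0 ≤ α) {Ξ : Measure (GraphSpace 1 X)} [IsProbabilityMeasure Ξ]
    (hΞ : IsUnimodular Ξ) : rate (Ξ.bind κ) ≤ α := by
  obtain ⟨κc, h1, h2, h3⟩ := exists_charge_law p α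
  let F : GraphSpace 2 X → ℝ≥0∞ := fun z => ∫⁻ y, y ∂κc z
  have hF : Measurable F := (Measure.measurable_lintegral measurable_id).comp h1
  have hFmk : ∀ G : MarkedGraph 2 X, F (GraphSpace.mk G) =
      ∫⁻ b, charge (G.openSubgraph p).Adj α b (G.root 0) (G.root 1) ∂coins G.V := fun G => by
    simp only [F]
    exact (congrArg (fun m => ∫⁻ y, y ∂m) (h3 G)).trans (lintegral_map measurable_id (h2 G))
  refine ENNReal.toReal_le_of_le_ofReal hα ?_
  rw [Measure.bind_apply measurableSet_root_closed h.measurable.aemeasurable]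
  calc _ ≤ ∫⁻ x, massIn F x ∂Ξ := lintegral_mono fun x => by
        induction x using Quotient.inductionOn with | _ G
        refine (h.apply measurableSet_root_closed G).le.trans ?_
        have hin : massIn F (GraphSpace.mk G) =
            ∫⁻ b, ∑' o, charge (G.openSubgraph p).Adj α b o (G.root 0) ∂coins G.V := by
          refine Eq.trans ?_ (lintegral_tsum fun o =>
            (h2 (G.withRoots ![o, G.root 0])).aemeasurable).symm
          exact tsum_congr fun o => hFmk (G.withRoots ![o, G.root 0])
        refine le_trans ?_ hin.ge
        refine meas_le_lintegral₀ (Measurable.tsum fun o =>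
          h2 (G.withRoots ![o, G.root 0])).aemeasurable fun b hb => one_le_tsum_charge ?_
        have hb := satisfies_mk_root_closed.1 hb
        by_contra hr
        exact absurd hb (ne_false_of_eq_true (@decide_eq_true _ (Classical.propDecidable _) hr))
    _ = ∫⁻ x, massOut F x ∂Ξ := (hΞ F hF).symm
    _ ≤ ∫⁻ _, ENNReal.ofReal α ∂Ξ := lintegral_mono fun x => by
        induction x using Quotient.inductionOn with | _ G
        have hout : massOut F (GraphSpace.mk G) =
            ∫⁻ b, ∑' o, charge (G.openSubgraph p).Adj α b (G.root 0) o ∂coins G.V := by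
          refine Eq.trans ?_ (lintegral_tsum fun o =>
            (h2 (G.withRoots ![G.root 0, o])).aemeasurable).symm
          exact tsum_congr fun o => hFmk (G.withRoots ![G.root 0, o])
        refine hout.le.trans ((lintegral_mono fun b => tsum_charge_le hα _).trans ?_)
        simp
    _ = ENNReal.ofReal α := by simp

end Bind

end LocalGraph

theorem theorem4p1
    -- the law of `(G, ρ)`
    (μ : MeasureTheory.Measure (LocalGraph.GraphSpace 1 Unit))
    (hμ : MeasureTheory.IsProbabilityMeasure μ) (hμu : LocalGraph.IsUnimodular μ)
    -- the law of `(G, ρ, ξ)`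
    (Ξ : MeasureTheory.Measure (LocalGraph.GraphSpace 1 (Unit × Bool)))
    (hΞ : LocalGraph.IsPercolation μ Ξ)
    (D : ℕ) (hD : 0 < D)
    (hdeg : ∀ᵐ x ∂Ξ, x.Satisfies fun G =>
      ∀ v ∈ (G.openSubgraph Prod.snd).verts,
        ((G.openSubgraph Prod.snd).neighborSet v).encard ≤ D)
    (α : ℝ) (hα : 0 < α) :
    -- the law of `(G, ρ, ξ, ω)`
    ∃ ν : MeasureTheory.Measure (LocalGraph.GraphSpace 1 ((Unit × Bool) × Bool)),
      LocalGraph.IsSitePercolation Ξ ν ∧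
      LocalGraph.rate ν ≤ α ∧
      ∀ᵐ x ∂ν, x.Satisfies fun G =>
        ∀ C : (G.openSubgraph (fun m => m.1.2) ⊓
            G.openSubgraph (fun m => m.2)).coe.ConnectedComponent,
          C.supp.Infinite → α ≤ C.toSimpleGraph.innerVertexExpansionConstant := by
  have := hΞ.isProbabilityMeasure
  obtain ⟨κ, h1, h2, h3⟩ := LocalGraph.exists_thinned_law (k := 1) (X := Unit × Bool) Prod.snd α
  have hκ : LocalGraph.IsThinnedLaw Prod.snd α κ := ⟨h1, h2, h3⟩
  have hgood := hκ.ae_isGood Ξ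
  refine ⟨Ξ.bind κ, ⟨⟨hκ.isMarking hΞ.isUnimodular, ?_⟩, ?_⟩, hκ.rate_le hα.le hΞ.isUnimodular, ?_⟩
  · filter_upwards [hgood] with x hx G hG u v huv
    exact ((hx G hG).1 u v huv).1
  · filter_upwards [hgood] with x hx G hG u v huv hu hv
    exact ((hx G hG).1 u v huv).2 ⟨hu, hv⟩
  · filter_upwards [hgood] with x hx G hG C hC
    exact (hx G hG).le_expansion C hC
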